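/- All $C^*$-algebras are over $\mathbb{C}$ and need be neither unital nor separable. For a $C^*$-algebra $A$ let $A_{\mathrm{sa}}$ be the set of its self-adjoint elements, and equip the space $A_{\mathrm{sa}}^k$ of self-adjoint $k$-tuples with the norm $\|(a_1,\dots,a_k)\|=\max_i\|a_i\|$. If $A$ is unital, its *generator rank* $\mathrm{gr}(A)$ is the smallest integer $k\ge 0$ such that the tuples $(a_1,\dots,a_{k+1})\in A_{\mathrm{sa}}^{k+1}$ that generate $A$ as a $C^*$-algebra (i.e. that are not contained in any proper sub-$C^*$-algebra, unital or not) are dense in $A_{\mathrm{sa}}^{k+1}$, and $\mathrm{gr}(A)=\infty$ if there is no such $k$. Likewise, the *real rank* $\mathrm{rr}(A)$ is the smallest integer $k\ge 0$ such that the tuples $(a_1,\dots,a_{k+1})\in A_{\mathrm{sa}}^{k+1}$ with $\sum_{i=1}^{k+1} a_i^*a_i$ invertible are dense in $A_{\mathrm{sa}}^{k+1}$, and $\mathrm{rr}(A)=\infty$ if there is no such $k$. If $A$ is not unital, put $\mathrm{gr}(A):=\mathrm{gr}(\widetilde A)$ and $\mathrm{rr}(A):=\mathrm{rr}(\widetilde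 A)$, where $\widetilde A$ is the $C^*$-algebra obtained from $A$ by adjoining a unit. **Proposition.** Let $A$ and $B$ be $C^*$-algebras of real rank zero. Then $$\mathrm{gr}(A\oplus B)=\max\{\mathrm{gr}(A),\mathrm{gr}(B)\}.$$ -/

import Mathlib

/-- `e` is a (two-sided) multiplicative identity of `A`. -/
def IsIdentity {A : Type*} [Mul A] (e : A) : Prop :=
  ∀ a : A, e * a = a ∧ a * e = a

/-- The C*-algebra `A` is unital. -/
def IsUnital (A : Type*) [Mul A] : Prop :=
  ∃ e : A, IsIdentity e

section CStar

variable (A : Type*) [NonUnitalCStarAlgebra A]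

/-- `C*(a)`: the sub-C*-algebra of `A` generated by the entries of the tuple `a`, i.e. the closure
of the (not necessarily unital) star-subalgebra that they generate. -/
def cstarGenerated {k : ℕ} (a : Fin k → A) : NonUnitalStarSubalgebra ℂ A :=
  (NonUnitalStarAlgebra.adjoin ℂ (Set.range a)).topologicalClosure

/-- `Gen_k(A)_sa`: the self-adjoint `k`-tuples that generate `A` as a C*-algebra, as a subset of
the space of all self-adjoint `k`-tuples. -/
def GenSA (k : ℕ) : Set (Fin k → selfAdjoint A) :=
  {a | cstarGenerated A (fun i => (a i : A)) = ⊤}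

/-- `Lg_k(A)_sa`: the self-adjoint `k`-tuples `a` for which `∑ i, a i ^* * a i` is invertible in
the unital C*-algebra `A`. (The set is empty if `A` has no identity; it is used for unital `A`
only.) -/
def LgSA (k : ℕ) : Set (Fin k → selfAdjoint A) :=
  {a | ∃ e b : A, IsIdentity e ∧
    b * (∑ i, star (a i : A) * (a i : A)) = e ∧ (∑ i, star (a i : A) * (a i : A)) * b = e}

/-- The generator rank of a unital C*-algebra: the smallest `k` such that `Gen_{k+1}(A)_sa` is
dense in the self-adjoint `(k+1)`-tuples, and `∞` if there is no such `k`. -/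
noncomputable def unitalGeneratorRank : ℕ∞ :=
  ⨅ (k : ℕ) (_ : Dense (GenSA A (k + 1))), (k : ℕ∞)

/-- The real rank of a unital C*-algebra: the smallest `k` such that `Lg_{k+1}(A)_sa` is dense in
the self-adjoint `(k+1)`-tuples, and `∞` if there is no such `k`. -/
noncomputable def unitalRealRank : ℕ∞ :=
  ⨅ (k : ℕ) (_ : Dense (LgSA A (k + 1))), (k : ℕ∞)

open Classical in
/-- The generator rank of a C*-algebra: that of its minimal unitization, which is `A` itself if
`A` is unital, and `A` with an identity adjoined otherwise. -/
noncomputable def generatorRank : ℕ∞ :=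
  if IsUnital A then unitalGeneratorRank A else unitalGeneratorRank (Unitization ℂ A)

open Classical in
/-- The real rank of a C*-algebra: that of its minimal unitization. -/
noncomputable def realRank : ℕ∞ :=
  if IsUnital A then unitalRealRank A else unitalRealRank (Unitization ℂ A)

end CStar

/-! Generator rank does not increase under quotients, so the point is that density of generating
`(k+1)`-tuples in both summands gives density in the sum. If `A` and `B` are unital, real rank zero
allows the first entry of a tuple to be perturbed so that its `A`-part has spectrum near `ε(ℤ +
1/4)` and its `B`-part near `ε(ℤ + 3/4)`. A continuous function separating these sets produces the
element `(1, 0)`, and two generating tuples then generate the sum (`dense_genSA_of_prod`). If only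
one summand is unital, the unitization of the sum is again a direct sum.

If neither is unital, that unitization is the pullback of the two unitizations over their scalar
characters, and the spectra share the character value, so they cannot be separated. Separation is
instead obtained up to a small error on a fixed element `c` supported in the first coordinate: both
parts take a common value in `ε(ℤ + 3/4)` at the characters, but the cutoff of the `A`-part is
almost a unit for `c` (`exists_near_norm_sub_bump_le`). Thus `c` is almost generated by a dense set
of tuples (`dense_nearGenSA_of_pullback`), a set that is also open. By Baire, a generic tuple
generates the kernel of the second coordinate map and projects to a generating tuple, hence
generates everything (`dense_genSA_of_pullback`). -/

instance selfAdjoint.instCompleteSpace {A : Type*} [NonUnitalCStarAlgebra A] :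
    CompleteSpace (selfAdjoint A) :=
  (isClosed_eq continuous_star continuous_id : IsClosed {x : A | star x = x}).completeSpace_coe

/-! ### Real rank zero and continuous functional calculus -/

section UnitalAnalysis

open Filter Topology

variable {P : Type*} [CStarAlgebra P]

theorem IsIdentity.eq_one {e : P} (h : IsIdentity e) : e = 1 := by
  simpa using (h 1).1

/-- In a unital C*-algebra of real rank zero the invertible self-adjoint elements are dense. -/
theorem dense_isUnit_of_unitalRealRank_eq_zero (h : unitalRealRank P = 0) :
    Dense {a : selfAdjoint P | IsUnit (a : P)} := by
  have hd : Dense (LgSA P 1) := by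
    by_contra hd
    have : (1 : ℕ∞) ≤ unitalRealRank P := by
      refine le_iInf₂ fun k hk => ?_
      rcases k with _ | k
      · exact absurd hk hd
      · exact_mod_cast Nat.succ_le_succ (Nat.zero_le k)
    rw [h] at this
    exact absurd this (by simp)
  have h1 : DenseRange fun a : Fin 1 → selfAdjoint P => a 0 :=
    Function.Surjective.denseRange fun x => ⟨fun _ => x, rfl⟩
  refine (h1.dense_image (continuous_apply 0) hd).mono ?_
  rintro _ ⟨a, ⟨e, b, he, h1, h2⟩, rfl⟩
  rw [he.eq_one] at h1 h2
  simp only [Fin.sum_univ_one, selfAdjoint.star_val_eq] at h1 h2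
  rw [← mul_assoc] at h1
  rw [mul_assoc] at h2
  exact isUnit_iff_exists_and_exists.2 ⟨⟨_, h2⟩, ⟨_, h1⟩⟩

/-- Each condition defines a translate of the open dense set of invertibles, so Baire in the
complete space `selfAdjoint P` handles all `j` at once. -/
theorem dense_forall_intCast_mul_notMem_spectrum
    (hP : Dense {a : selfAdjoint P | IsUnit (a : P)}) (ε : ℝ) :
    Dense {a : selfAdjoint P | ∀ j : ℤ, (j * ε : ℝ) ∉ spectrum ℝ (a : P)} := by
  have key (t : ℝ) : IsOpen {a : selfAdjoint P | t ∉ spectrum ℝ (a : P)} ∧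
      Dense {a : selfAdjoint P | t ∉ spectrum ℝ (a : P)} := by
    let φ : selfAdjoint P ≃ₜ selfAdjoint P := Homeomorph.subRight (t • 1)
    have : {a : selfAdjoint P | t ∉ spectrum ℝ (a : P)} =
        φ ⁻¹' {a : selfAdjoint P | IsUnit (a : P)} := by
      ext a
      simp only [Set.mem_ofPred_eq, spectrum.mem_iff, not_not, Set.mem_preimage, φ,
        Homeomorph.coe_subRight]
      rw [← IsUnit.neg_iff, neg_sub, Algebra.algebraMap_eq_smul_one]
      simp
    rw [this]
    exact ⟨(Units.isOpen.preimage continuous_subtype_val).preimage φ.continuous,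
      hP.preimage φ.isOpenMap⟩
  have := dense_iInter_of_isOpen (fun j : ℤ => (key (j * ε)).1) (fun j : ℤ => (key (j * ε)).2)
  simpa only [Set.ofPred_forall] using this

theorem exists_near_forall_intCast_mul_notMem_spectrum
    (hP : Dense {a : selfAdjoint P | IsUnit (a : P)}) (ε : ℝ) {a : P} (ha : IsSelfAdjoint a)
    {δ : ℝ} (hδ : 0 < δ) :
    ∃ b : P, IsSelfAdjoint b ∧ ‖b - a‖ < δ ∧ ∀ j : ℤ, (j * ε : ℝ) ∉ spectrum ℝ b := by
  obtain ⟨b, hb, hb'⟩ := (dense_forall_intCast_mul_notMem_spectrum hP ε).exists_dist_lt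
    (⟨a, ha⟩ : selfAdjoint P) hδ
  refine ⟨b, b.2, ?_, hb⟩
  rw [dist_comm, dist_eq_norm] at hb'
  exact hb'

/-- The step function with step `ε` whose value on `[jε, (j+1)ε)` is `(j+θ)ε`. -/
noncomputable def stepFun (ε θ t : ℝ) : ℝ := ε * (⌊t / ε⌋ + θ)

theorem abs_stepFun_sub_le {ε θ : ℝ} (hε : 0 < ε) (h0 : 0 ≤ θ) (h1 : θ ≤ 1) (t : ℝ) :
    |stepFun ε θ t - t| ≤ ε := by
  have e1 : stepFun ε θ t - t = ε * (θ - Int.fract (t / ε)) := by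
    have h2 : t = ε * (⌊t / ε⌋ + Int.fract (t / ε)) := by
      rw [Int.floor_add_fract]; field_simp
    rw [stepFun]
    linear_combination -h2
  rw [e1, abs_mul, abs_of_pos hε]
  have h3 := Int.fract_nonneg (t / ε)
  have h4 := (Int.fract_lt_one (t / ε)).le
  have : |θ - Int.fract (t / ε)| ≤ 1 := abs_le.2 ⟨by linarith, by linarith⟩
  nlinarith

theorem continuousOn_stepFun {ε : ℝ} (hε : 0 < ε) (θ : ℝ) :
    ContinuousOn (stepFun ε θ) {t | ∀ j : ℤ, t ≠ j * ε} := by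
  intro t ht
  refine ContinuousAt.continuousWithinAt ?_
  have h1 : (⌊t / ε⌋ : ℝ) < t / ε := by
    refine lt_of_le_of_ne (Int.floor_le _) fun h => ht ⌊t / ε⌋ ?_
    rw [h]; field_simp
  have h2 := Int.lt_floor_add_one (t / ε)
  have h3 : ∀ᶠ s in 𝓝 t, s / ε ∈ Set.Ioo (⌊t / ε⌋ : ℝ) (⌊t / ε⌋ + 1) :=
    (continuous_id.div_const ε).continuousAt.eventually (Ioo_mem_nhds h1 h2)
  refine (continuousAt_const (y := stepFun ε θ t)).congr ?_
  filter_upwards [h3] with s hs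
  rw [stepFun, stepFun, Int.floor_eq_iff.2 ⟨hs.1.le, hs.2⟩]

theorem continuousOn_stepFun_spectrum {ε : ℝ} (hε : 0 < ε) (θ : ℝ) {b : P}
    (hb : ∀ j : ℤ, (j * ε : ℝ) ∉ spectrum ℝ b) : ContinuousOn (stepFun ε θ) (spectrum ℝ b) :=
  (continuousOn_stepFun hε θ).mono fun _ ht j hj => hb j (hj ▸ ht)

/-- In real rank zero, self-adjoint elements can be approximated by ones with spectrum in a
prescribed arithmetic progression. -/
theorem exists_near_spectrum_subset_progression
    (hP : Dense {a : selfAdjoint P | IsUnit (a : P)}) {a : P} (ha : IsSelfAdjoint a)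
    {ε θ : ℝ} (hε : 0 < ε) (h0 : 0 ≤ θ) (h1 : θ ≤ 1) :
    ∃ b : P, IsSelfAdjoint b ∧ ‖b - a‖ ≤ 2 * ε ∧
      ∀ t ∈ spectrum ℝ b, ∃ j : ℤ, t = ε * (j + θ) := by
  obtain ⟨b, hb, hba, hs⟩ := exists_near_forall_intCast_mul_notMem_spectrum hP ε ha hε
  have hc := continuousOn_stepFun_spectrum hε θ hs
  refine ⟨cfc (stepFun ε θ) b, cfc_predicate _ _, ?_, ?_⟩
  · have h2 : ‖cfc (stepFun ε θ) b - b‖ ≤ ε := by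
      conv_lhs => enter [1, 2]; rw [← cfc_id ℝ b]
      rw [← cfc_sub _ _ b hc]
      exact norm_cfc_le hε.le fun t _ => abs_stepFun_sub_le hε h0 h1 t
    calc _ ≤ ‖cfc (stepFun ε θ) b - b‖ + ‖b - a‖ := norm_sub_le_norm_sub_add_norm_sub _ _ _
      _ ≤ _ := by linarith
  · intro t ht
    rw [cfc_map_spectrum (stepFun ε θ) b hb hc] at ht
    obtain ⟨s, -, rfl⟩ := ht
    exact ⟨_, rfl⟩

theorem abs_le_norm_of_mem_spectrum {a : P} (ha : IsSelfAdjoint a) {t : ℝ}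
    (ht : t ∈ spectrum ℝ a) : |t| ≤ ‖a‖ := by
  have := norm_apply_le_norm_cfc (id : ℝ → ℝ) a ht
  rwa [cfc_id ℝ a] at this

theorem exists_forall_norm_cfc_sub_lt {f : ℝ → ℝ} (hf : Continuous f) {a : P}
    (ha : IsSelfAdjoint a) {δ : ℝ} (hδ : 0 < δ) :
    ∃ η > 0, ∀ b : P, IsSelfAdjoint b → ‖b - a‖ < η → ‖cfc f b - cfc f a‖ < δ := by
  have hs : IsCompact (Set.Icc (-(‖a‖ + 1)) (‖a‖ + 1)) := isCompact_Icc
  have hc := continuousOn_cfc P hs f hf.continuousOn (p := IsSelfAdjoint) a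
    ⟨ha, fun t ht => abs_le.1 ((abs_le_norm_of_mem_spectrum ha ht).trans (by linarith))⟩
  obtain ⟨η, hη, h⟩ := Metric.continuousWithinAt_iff.1 hc δ hδ
  refine ⟨min η 1, lt_min hη one_pos, fun b hb hba => ?_⟩
  rw [← dist_eq_norm]
  refine h ⟨hb, fun t ht => abs_le.1 ((abs_le_norm_of_mem_spectrum hb ht).trans ?_)⟩ ?_
  · have h1 := norm_le_norm_add_norm_sub' b a
    have h2 := hba.le.trans (min_le_right _ _)
    linarith
  · rw [dist_eq_norm]; exact hba.trans_le (min_le_left _ _)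

theorem exists_forall_spectrum_subset {U : Set ℝ} (hU : IsOpen U) {a : P}
    (h : spectrum ℝ a ⊆ U) :
    ∃ η > 0, ∀ b : P, ‖b - a‖ < η → spectrum ℝ b ⊆ U := by
  have h1 := upperHemicontinuous_spectrum ℝ P a U (hU.mem_nhdsSet.2 h)
  obtain ⟨η, hη, h2⟩ := Metric.eventually_nhds_iff.1 h1
  exact ⟨η, hη, fun b hb => hU.mem_nhdsSet.1 (h2 (by rwa [dist_eq_norm]))⟩

/-- The continuous functional calculus respects intertwining relations. -/
theorem cfc_mul_eq_mul_cfc {a b p : P} (ha : IsSelfAdjoint a) (hb : IsSelfAdjoint b)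
    (h : a * p = p * b) {f : ℝ → ℝ} (hf : Continuous f) : cfc f a * p = p * cfc f b := by
  have hpoly (q : Polynomial ℝ) : cfc q.eval a * p = p * cfc q.eval b := by
    rw [cfc_polynomial q a, cfc_polynomial q b]
    induction q using Polynomial.induction_on' with
    | add q r hq hr => simp only [map_add, add_mul, mul_add, hq, hr]
    | monomial n c =>
      have h2 : a ^ n * p = p * b ^ n := by
        induction n with
        | zero => simp
        | succ n ih => rw [pow_succ', mul_assoc, ih, ← mul_assoc, h, mul_assoc, ← pow_succ']
      rw [Polynomial.aeval_monomial, Polynomial.aeval_monomial, ← Algebra.smul_def,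
        ← Algebra.smul_def, smul_mul_assoc, mul_smul_comm, h2]
  set M := max ‖a‖ ‖b‖
  rw [← sub_eq_zero, ← norm_le_zero_iff]
  refine le_of_forall_pos_le_add fun ε hε => ?_
  -- The polynomial case is algebraic; two approximation errors remain, each multiplied by `‖p‖`.
  obtain ⟨q, hq⟩ := exists_polynomial_near_of_continuousOn (-M) M f hf.continuousOn
    (ε / (2 * (‖p‖ + 1))) (by positivity)
  have hd {c : P} (hc : IsSelfAdjoint c) (hcM : ‖c‖ ≤ M) :
      ‖cfc f c - cfc q.eval c‖ ≤ ε / (2 * (‖p‖ + 1)) := by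
    rw [← cfc_sub f q.eval c hf.continuousOn q.continuous.continuousOn]
    refine norm_cfc_le (by positivity) fun t ht => ?_
    rw [Real.norm_eq_abs, abs_sub_comm]
    exact (hq t (abs_le.1 ((abs_le_norm_of_mem_spectrum hc ht).trans hcM))).le
  have e : cfc f a * p - p * cfc f b =
      (cfc f a - cfc q.eval a) * p - p * (cfc f b - cfc q.eval b) := by
    rw [sub_mul, mul_sub, hpoly]; abel
  rw [e, zero_add]
  calc _ ≤ ‖(cfc f a - cfc q.eval a) * p‖ + ‖p * (cfc f b - cfc q.eval b)‖ := norm_sub_le _ _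
    _ ≤ ε / (2 * (‖p‖ + 1)) * ‖p‖ + ‖p‖ * (ε / (2 * (‖p‖ + 1))) := by
      refine add_le_add ((norm_mul_le _ _).trans ?_) ((norm_mul_le _ _).trans ?_)
      · exact mul_le_mul_of_nonneg_right (hd ha (le_max_left _ _)) (norm_nonneg _)
      · exact mul_le_mul_of_nonneg_left (hd hb (le_max_right _ _)) (norm_nonneg _)
    _ ≤ ε := by
      have h3 : 0 < ‖p‖ + 1 := by positivity
      rw [show ε / (2 * (‖p‖ + 1)) * ‖p‖ + ‖p‖ * (ε / (2 * (‖p‖ + 1))) = ε * (‖p‖ / (‖p‖ + 1)) by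
        field_simp; ring]
      have : ‖p‖ / (‖p‖ + 1) ≤ 1 := (div_le_one h3).2 (by linarith)
      nlinarith

theorem IsStarProjection.norm_le_one' {p : P} (hp : IsStarProjection p) : ‖p‖ ≤ 1 := by
  have h : ‖p‖ = ‖p‖ * ‖p‖ := by
    conv_lhs => rw [← hp.isIdempotentElem.eq]
    conv_lhs => enter [1, 1]; rw [← hp.isSelfAdjoint.star_eq]
    exact CStarRing.norm_star_mul_self
  nlinarith [norm_nonneg p]

/-- The functional calculus of a block diagonal element whose second block is scalar. -/
theorem cfc_block {p a : P} (hp : IsStarProjection p) (ha : IsSelfAdjoint a) (K : ℝ)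
    {f : ℝ → ℝ} (hf : Continuous f) :
    cfc f (p * a * p + K • (1 - p)) = p * cfc f (p * a * p) + f K • (1 - p) := by
  have hpp : p * p = p := hp.isIdempotentElem
  have hs : star p = p := hp.isSelfAdjoint
  have hu : IsSelfAdjoint (p * a * p) := by
    rw [isSelfAdjoint_iff]; simp [hs, ha.star_eq, mul_assoc]
  have hq : IsSelfAdjoint (1 - p) := (IsSelfAdjoint.one P).sub hp.isSelfAdjoint
  have hv : IsSelfAdjoint (p * a * p + K • (1 - p)) := hu.add ((IsSelfAdjoint.all K).smul hq)
  -- The block element is intertwined with `p * a * p` by `p` and with the scalar `K` by `1 - p`;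
  -- adding the two resulting identities gives the formula.
  have h1 := cfc_mul_eq_mul_cfc hv hu (p := p)
    (by simp only [add_mul, smul_mul_assoc, sub_mul, one_mul, hpp, sub_self, smul_zero, add_zero,
          mul_assoc]
        rw [← mul_assoc p p, hpp]) hf
  have h2 := cfc_mul_eq_mul_cfc hv (b := algebraMap ℝ P K)
    (.algebraMap P (IsSelfAdjoint.all K)) (p := 1 - p)
    (by rw [← Algebra.commutes, ← Algebra.smul_def]
        simp [mul_sub, add_mul, sub_mul, mul_assoc, hpp]) hf
  rw [cfc_algebraMap, ← Algebra.commutes, ← Algebra.smul_def] at h2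
  rw [← h1, ← h2, ← mul_add]
  simp

/-- The continuous cutoff separating `ε (ℤ + 1/4)` from `ε (ℤ + 3/4)` and `0`. -/
noncomputable def bump (ε t : ℝ) : ℝ := min 1 (max 0 (2 * Real.sin (2 * Real.pi * (t / ε))))

theorem continuous_bump (ε : ℝ) : Continuous (bump ε) := by
  unfold bump; fun_prop

-- Vanishing at `0` keeps the cutoff inside generated subalgebras, which are not assumed unital.
@[simp] theorem bump_zero (ε : ℝ) : bump ε 0 = 0 := by simp [bump]

theorem bump_eq_one {ε t : ℝ} (h : 1 / 2 ≤ Real.sin (2 * Real.pi * (t / ε))) : bump ε t = 1 := by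
  rw [bump, max_eq_right (by linarith), min_eq_left (by linarith)]

theorem bump_eq_zero {ε t : ℝ} (h : Real.sin (2 * Real.pi * (t / ε)) ≤ 0) : bump ε t = 0 := by
  rw [bump, max_eq_left (by linarith), min_eq_right (by linarith)]

theorem abs_bump_le_one (ε t : ℝ) : |bump ε t| ≤ 1 :=
  abs_le.2 ⟨by have : 0 ≤ bump ε t := le_min zero_le_one (le_max_left _ _)
               linarith, min_le_left _ _⟩

theorem sin_quarter {ε : ℝ} (hε : 0 < ε) (j : ℤ) :
    Real.sin (2 * Real.pi * (ε * (j + 1 / 4) / ε)) = 1 := by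
  rw [mul_div_cancel_left₀ _ hε.ne',
    show 2 * Real.pi * ((j : ℝ) + 1 / 4) = Real.pi / 2 + j * (2 * Real.pi) by ring,
    Real.sin_add_int_mul_two_pi, Real.sin_pi_div_two]

theorem sin_three_quarters {ε : ℝ} (hε : 0 < ε) (j : ℤ) :
    Real.sin (2 * Real.pi * (ε * (j + 3 / 4) / ε)) = -1 := by
  rw [mul_div_cancel_left₀ _ hε.ne',
    show 2 * Real.pi * ((j : ℝ) + 3 / 4) = -(Real.pi / 2) + (j + 1 : ℤ) * (2 * Real.pi) by
      push_cast; ring,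
    Real.sin_add_int_mul_two_pi, Real.sin_neg, Real.sin_pi_div_two]

end UnitalAnalysis

/-! ### Characters and approximate units of projections in their kernels -/

section Characters

open scoped CStarAlgebra

variable {P : Type*} [CStarAlgebra P]

theorem StarAlgHom.exists_real_eq (χ : P →⋆ₐ[ℂ] ℂ) {a : P} (ha : IsSelfAdjoint a) :
    ∃ r : ℝ, χ a = r ∧ r ∈ spectrum ℝ a := by
  obtain ⟨r, hr⟩ : ∃ r : ℝ, (r : ℂ) = χ a := Complex.conj_eq_iff_real.1 (ha.map χ) |>.imp
    fun _ h => h.symm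
  refine ⟨r, hr.symm, ?_⟩
  rw [← spectrum.algebraMap_mem_iff ℂ]
  change (r : ℂ) ∈ _
  rw [hr]
  exact AlgHom.apply_mem_spectrum χ a

theorem StarAlgHom.apply_cfc (χ : P →⋆ₐ[ℂ] ℂ) {a : P} (ha : IsSelfAdjoint a) {r : ℝ}
    (hr : χ a = r) {f : ℝ → ℝ} (hf : ContinuousOn f (spectrum ℝ a)) : χ (cfc f a) = f r := by
  rw [StarAlgHomClass.map_cfc χ f a hf (map_continuous χ) ha (ha.map χ), hr]
  exact cfc_algebraMap r f

theorem IsStarProjection.norm_sub_mul_mul_le {p c : P} (hp : IsStarProjection p)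
    (hc : IsSelfAdjoint c) : ‖c - p * c * p‖ ≤ 2 * ‖c * (1 - p)‖ := by
  have e : c - p * c * p = star (c * (1 - p)) + p * (c * (1 - p)) := by
    rw [star_mul, hc.star_eq, hp.one_sub.isSelfAdjoint.star_eq]
    noncomm_ring
  rw [e]
  refine (norm_add_le _ _).trans ?_
  rw [norm_star, two_mul]
  refine add_le_add_right ((norm_mul_le _ _).trans ?_) _
  exact mul_le_of_le_one_left (norm_nonneg _) hp.norm_le_one'

theorem norm_mul_mul_sub_le (c : P) {p q : P} (hp : ‖p‖ ≤ 1) (hq : ‖q‖ ≤ 1) :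
    ‖q * c * q - p * c * p‖ ≤ 2 * (‖q - p‖ * ‖c‖) := by
  have e1 : q * c * q - p * c * p = (q - p) * c * q + p * c * (q - p) := by
    noncomm_ring
  have h4 : ‖(q - p) * c * q‖ ≤ ‖q - p‖ * ‖c‖ :=
    (norm_mul_le _ _).trans <| (mul_le_of_le_one_right (norm_nonneg _) hq).trans <|
      norm_mul_le _ _
  have h5 : ‖p * c * (q - p)‖ ≤ ‖c‖ * ‖q - p‖ :=
    (norm_mul_le _ _).trans <| mul_le_mul_of_nonneg_right ((norm_mul_le _ _).trans <|
      mul_le_of_le_one_left (norm_nonneg _) hp) (norm_nonneg _)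
  rw [e1]
  linarith [norm_add_le ((q - p) * c * q) (p * c * (q - p))]

theorem norm_mul_sq_le_of_add_sq {c d q : P} (hc : IsSelfAdjoint c) (hd : IsSelfAdjoint d)
    (hq : IsSelfAdjoint q) :
    ‖c * q‖ ^ 2 ≤ ‖q * (c * c + d * d) * q‖ := by
  let _ := CStarAlgebra.spectralOrder P
  have := CStarAlgebra.spectralOrderedRing P
  have e1 : q * (c * c + d * d) * q = star (c * q) * (c * q) + star (d * q) * (d * q) := by
    simp only [star_mul, hc.star_eq, hd.star_eq, hq.star_eq]
    noncomm_ring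
  rw [sq, ← CStarRing.norm_star_mul_self, e1]
  exact CStarAlgebra.norm_le_norm_of_nonneg_of_le (star_mul_self_nonneg _)
    (le_add_of_nonneg_right (star_mul_self_nonneg _))

/-- In real rank zero, the kernel of a character contains projections that are approximate units
for two given self-adjoint elements of the kernel. -/
theorem exists_isStarProjection_norm_sub_le (hP : Dense {a : selfAdjoint P | IsUnit (a : P)})
    (χ : P →⋆ₐ[ℂ] ℂ) {c d : P} (hc : IsSelfAdjoint c) (hd : IsSelfAdjoint d)
    (hχc : χ c = 0) (hχd : χ d = 0) {η : ℝ} (hη : 0 < η) :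
    ∃ p : P, IsStarProjection p ∧ χ p = 0 ∧ ‖c - p * c * p‖ ≤ η ∧ ‖d - p * d * p‖ ≤ η := by
  -- Two errors of `2 * ε` add up to `(η / 2) ^ 2`.
  set ε : ℝ := η ^ 2 / 16 with hεdef
  have hε : 0 < ε := by positivity
  have he : IsSelfAdjoint (c * c + d * d) := by
    rw [isSelfAdjoint_iff]; simp [hc.star_eq, hd.star_eq]
  obtain ⟨e, hes, hee, hspec⟩ := exists_near_spectrum_subset_progression hP he (θ := 1 / 4) hε
    (by norm_num) (by norm_num)
  -- No point of `ε(ℤ + 1/4)` has modulus strictly between `2 * ε` and `9/4 * ε`, so `k` is `0` or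
  -- `1` on the spectrum of `e` and `cfc k e` is a projection. Since `χ` kills `c * c + d * d`, also
  -- `|χ e| ≤ 2 * ε`, where `k` vanishes.
  obtain ⟨k, hk, k0, k1⟩ : ∃ k : ℝ → ℝ, Continuous k ∧ (∀ t, |t / ε| ≤ 2 → k t = 0) ∧
      ∀ t, 9 / 4 ≤ |t / ε| → k t = 1 := by
    refine ⟨fun t => min 1 (max 0 (4 * |t / ε| - 8)), by fun_prop, fun t h => ?_, fun t h => ?_⟩
    · beta_reduce
      rw [max_eq_left (by linarith), min_eq_right (by linarith)]
    · beta_reduce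
      rw [max_eq_right (by linarith), min_eq_left (by linarith)]
  have hk01 : ∀ t ∈ spectrum ℝ e, (k t = 0 ∧ |t| ≤ 2 * ε) ∨ k t = 1 := by
    intro t ht
    obtain ⟨j, rfl⟩ := hspec t ht
    have hdiv : ε * ((j : ℝ) + 1 / 4) / ε = j + 1 / 4 := by field_simp
    by_cases h : j ≤ 1 ∧ -2 ≤ j
    · have h1 : (j : ℝ) ≤ 1 := by exact_mod_cast h.1
      have h2 : (-2 : ℝ) ≤ j := by exact_mod_cast h.2
      have h3 : |(j : ℝ) + 1 / 4| ≤ 2 := abs_le.2 ⟨by linarith, by linarith⟩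
      refine Or.inl ⟨k0 _ (by rwa [hdiv]), ?_⟩
      rw [abs_mul, abs_of_pos hε, mul_comm]
      exact mul_le_mul_of_nonneg_right h3 hε.le
    · refine Or.inr (k1 _ ?_)
      rw [hdiv]
      rcases (by omega : 2 ≤ j ∨ j ≤ -3) with h | h
      · have : (2 : ℝ) ≤ j := by exact_mod_cast h
        exact le_trans (by linarith) (le_abs_self _)
      · have : (j : ℝ) ≤ -3 := by exact_mod_cast h
        exact le_trans (by linarith) (neg_le_abs _)
  have hp : IsStarProjection (cfc k e) := by
    refine ⟨?_, cfc_predicate _ _⟩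
    rw [IsIdempotentElem, ← cfc_mul k k e hk.continuousOn hk.continuousOn]
    refine cfc_congr fun t ht => ?_
    rcases hk01 t ht with ⟨h, -⟩ | h <;> simp [h]
  have hbound : ‖(1 - cfc k e) * e * (1 - cfc k e)‖ ≤ 2 * ε := by
    have e1 : (1 - cfc k e) * e * (1 - cfc k e) =
        cfc (fun t => (1 - k t) * t * (1 - k t)) e := by
      have h1 : ContinuousOn (fun t => 1 - k t) (spectrum ℝ e) := by fun_prop
      rw [cfc_mul (fun t => (1 - k t) * t) (fun t => 1 - k t) e (h1.mul continuousOn_id) h1,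
        cfc_mul (fun t => 1 - k t) (fun t => t) e h1 continuousOn_id,
        cfc_sub (fun _ => (1 : ℝ)) k e continuousOn_const hk.continuousOn, cfc_id' ℝ e,
        cfc_const_one ℝ e]
    rw [e1]
    refine norm_cfc_le (by positivity) fun t ht => ?_
    rcases hk01 t ht with ⟨h, h'⟩ | h
    · simpa [h] using h'
    · simp [h, hε.le]
  have hfin : ‖(1 - cfc k e) * (c * c + d * d) * (1 - cfc k e)‖ ≤ (η / 2) ^ 2 := by
    have e1 : (1 - cfc k e) * (c * c + d * d) * (1 - cfc k e) =
      (1 - cfc k e) * e * (1 - cfc k e) - (1 - cfc k e) * (e - (c * c + d * d)) * (1 - cfc k e) := by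
      noncomm_ring
    have h1 := hp.one_sub.norm_le_one'
    have h2 : ‖(1 - cfc k e) * (e - (c * c + d * d)) * (1 - cfc k e)‖ ≤ 2 * ε :=
      calc _ ≤ ‖(1 - cfc k e) * (e - (c * c + d * d))‖ * ‖1 - cfc k e‖ := norm_mul_le _ _
        _ ≤ ‖(1 - cfc k e) * (e - (c * c + d * d))‖ := mul_le_of_le_one_right (norm_nonneg _) h1
        _ ≤ ‖1 - cfc k e‖ * ‖e - (c * c + d * d)‖ := norm_mul_le _ _
        _ ≤ ‖e - (c * c + d * d)‖ := mul_le_of_le_one_left (norm_nonneg _) h1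
        _ ≤ _ := hee
    rw [e1]
    refine (norm_sub_le _ _).trans ?_
    rw [hεdef] at h2 hbound
    linarith
  have hfin' : ‖(1 - cfc k e) * (d * d + c * c) * (1 - cfc k e)‖ ≤ (η / 2) ^ 2 := by
    rwa [add_comm (d * d)]
  have hsa := hp.one_sub.isSelfAdjoint
  refine ⟨cfc k e, hp, ?_, ?_, ?_⟩
  · obtain ⟨r, hr, -⟩ := χ.exists_real_eq hes
    rw [χ.apply_cfc hes hr hk.continuousOn, k0, Complex.ofReal_zero]
    have h1 : χ (e - (c * c + d * d)) = r := by simp [hr, hχc, hχd]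
    have h2 : |r| ≤ 2 * ε := by
      rw [← Real.norm_eq_abs, ← Complex.norm_real, ← h1]
      exact (NonUnitalStarAlgHom.norm_apply_le χ _).trans hee
    rw [abs_div, abs_of_pos hε]
    exact (div_le_iff₀ hε).2 h2
  · have := abs_le_of_sq_le_sq ((norm_mul_sq_le_of_add_sq hc hd hsa).trans hfin) (by positivity)
    linarith [hp.norm_sub_mul_mul_le hc, le_abs_self ‖c * (1 - cfc k e)‖]
  · have := abs_le_of_sq_le_sq ((norm_mul_sq_le_of_add_sq hd hc hsa).trans hfin') (by positivity)
    linarith [hp.norm_sub_mul_mul_le hd, le_abs_self ‖d * (1 - cfc k e)‖]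

/-- In real rank zero, a self-adjoint element can be perturbed so that it takes a prescribed
nearby value `μ` at a character, while a given self-adjoint element of the kernel of the character
is almost supported on a spectral projection of the perturbation away from `μ`. -/
theorem exists_near_norm_sub_bump_le (hP : Dense {a : selfAdjoint P | IsUnit (a : P)})
    (χ : P →⋆ₐ[ℂ] ℂ) {x c : P} (hx : IsSelfAdjoint x) (hc : IsSelfAdjoint c) (hχc : χ c = 0)
    {ε r μ : ℝ} (hε : 0 < ε) (hr : χ x = r) (hμr : |μ - r| ≤ 2 * ε)
    (hμ : Real.sin (2 * Real.pi * (μ / ε)) = -1) {η : ℝ} (hη : 0 < η) :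
    ∃ y : P, IsSelfAdjoint y ∧ χ y = μ ∧ ‖y - x‖ ≤ 5 * ε ∧
      ‖c - cfc (bump ε) y * c * cfc (bump ε) y‖ ≤ η := by
  have hsmul (s : ℝ) : IsSelfAdjoint (s • (1 : P)) := (IsSelfAdjoint.all s).smul (.one P)
  have hχ1 (s : ℝ) : χ (s • (1 : P)) = s := by
    rw [← Complex.coe_smul, map_smul, map_one]; simp
  obtain ⟨p, hp, hχp, hpc, hpd⟩ := exists_isStarProjection_norm_sub_le hP χ hc (hx.sub (hsmul r))
    hχc (by rw [map_sub, hr, hχ1, sub_self]) (lt_min hε (half_pos hη))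
  replace hpc := hpc.trans (min_le_right _ _)
  replace hpd := hpd.trans (min_le_left _ _)
  have hpp : p * p = p := hp.isIdempotentElem
  -- The target is near `p * a * p + μ • (1 - p)`, whose value at `χ` is `μ` and which is within `3
  -- * ε` of `x`.
  set a : P := x + (μ - r) • 1 with hadef
  have ha : IsSelfAdjoint a := hx.add (hsmul _)
  set M : ℝ := ‖a‖
  have hu : IsSelfAdjoint (p * a * p) := by
    rw [isSelfAdjoint_iff]; simp [hp.isSelfAdjoint.star_eq, ha.star_eq, mul_assoc]
  have huM : ‖p * a * p‖ ≤ M :=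
    (norm_mul_le _ _).trans <| (mul_le_of_le_one_right (norm_nonneg _) hp.norm_le_one').trans <|
      (norm_mul_le _ _).trans <| mul_le_of_le_one_left (norm_nonneg _) hp.norm_le_one'
  have huspec : ∀ t ∈ spectrum ℝ (p * a * p), t ≤ M := fun t ht =>
    (le_abs_self t).trans ((abs_le_norm_of_mem_spectrum hu ht).trans huM)
  -- Moving the second block to `M + 3`, beyond the spectrum of the first, makes `p` a spectral
  -- projection of `v`. The perturbation can then be done in `P`, and functional calculus recovers
  -- the blocks.
  set v : P := p * a * p + (M + 3) • (1 - p) with hvdef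
  have hv : IsSelfAdjoint v :=
    hu.add ((IsSelfAdjoint.all (M + 3)).smul hp.one_sub.isSelfAdjoint)
  have hvspec : spectrum ℝ v ⊆ Set.Iio (M + 1) ∪ Set.Ioi (M + 2) := by
    -- `F` vanishes on `(-∞, M]` and at `M + 3`, so `F(v) = 0`, while `F > 0` on the claimed gap.
    let F : ℝ → ℝ := fun t => min (max (t - M) 0) |t - (M + 3)|
    have hF : Continuous F := by fun_prop
    have h0 : cfc F v = cfc (0 : ℝ → ℝ) v := by
      have : cfc F (p * a * p) = cfc (0 : ℝ → ℝ) (p * a * p) := cfc_congr fun t ht => by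
        have := huspec t ht
        simp [F, max_eq_right (sub_nonpos.2 this)]
      rw [hvdef, cfc_block hp ha _ hF, this]
      simp [F]
    intro t ht
    have h1 := (cfc_eq_cfc_iff_eqOn (a := v)).1 h0 ht
    simp only [F, Pi.zero_apply] at h1
    by_contra h2
    simp only [Set.mem_union, Set.mem_Iio, Set.mem_Ioi, not_or, not_lt] at h2
    have h3 : 0 < min (max (t - M) 0) |t - (M + 3)| :=
      lt_min (lt_max_of_lt_left (by linarith)) (abs_pos.2 (by intro h; linarith))
    linarith
  let k : ℝ → ℝ := fun t => min 1 (max 0 (M + 2 - t))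
  have hk : Continuous k := by fun_prop
  have hk1 {t : ℝ} (h : t ≤ M + 1) : k t = 1 := by
    simp only [k]; rw [max_eq_right (by linarith), min_eq_left (by linarith)]
  have hk0 {t : ℝ} (h : M + 2 ≤ t) : k t = 0 := by
    simp only [k]; rw [max_eq_left (by linarith), min_eq_right (by linarith)]
  have hkb (t : ℝ) : |k t| ≤ 1 :=
    abs_le.2 ⟨by have : 0 ≤ k t := le_min zero_le_one (le_max_left _ _)
                 linarith, min_le_left _ _⟩
  let f₀ : ℝ → ℝ := fun t => t * k t + μ * (1 - k t)
  have hf₀ : Continuous f₀ := by fun_prop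
  have hkv : cfc k v = p := by
    have : cfc k (p * a * p) = cfc (fun _ => (1 : ℝ)) (p * a * p) := cfc_congr fun t ht =>
      hk1 ((huspec t ht).trans (by linarith))
    rw [hvdef, cfc_block hp ha _ hk, this, cfc_const_one ℝ (p * a * p), hk0 (by linarith)]
    simp
  have hfv : cfc f₀ v = p * a * p + μ • (1 - p) := by
    have : cfc f₀ (p * a * p) = cfc (fun t : ℝ => t) (p * a * p) := cfc_congr fun t ht => by
      simp [f₀, hk1 ((huspec t ht).trans (by linarith))]
    rw [hvdef, cfc_block hp ha _ hf₀, this, cfc_id' ℝ (p * a * p), ← mul_assoc, ← mul_assoc, hpp]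
    simp [f₀, hk0 (show M + 2 ≤ M + 3 by linarith)]
  obtain ⟨δ₁, hδ₁, h₁⟩ := exists_forall_norm_cfc_sub_lt hf₀ hv hε
  obtain ⟨δ₂, hδ₂, h₂⟩ := exists_forall_norm_cfc_sub_lt hk hv
    (show 0 < η / (4 * (‖c‖ + 1)) by positivity)
  obtain ⟨δ₃, hδ₃, h₃⟩ := exists_forall_spectrum_subset (isOpen_Iio.union isOpen_Ioi) hvspec
  -- The bounds `δ₁`, `δ₂`, `δ₃` control `f₀(w)`, the cutoff `k(w)` near `p`, and the spectral gap;
  -- the bound `1` keeps the value of `χ` at `w` above `M + 2`, where `k` vanishes.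
  obtain ⟨w, hw, hwv, hwspec⟩ := exists_near_forall_intCast_mul_notMem_spectrum hP ε hv
    (δ := min (min δ₁ δ₂) (min δ₃ 1)) (by positivity)
  simp only [lt_min_iff] at hwv
  replace h₁ := h₁ w hw hwv.1.1
  replace h₂ := h₂ w hw hwv.1.2
  replace h₃ := h₃ w hwv.2.1
  have hstep := continuousOn_stepFun_spectrum hε (1 / 4) hwspec
  -- Below the gap `F` lands in `ε(ℤ + 1/4)`, where the bump is `1`; above it `F` is `μ`, where the
  -- bump is `0`. Hence the bump of `F(w)` is `k(w)`.
  let F : ℝ → ℝ := fun t => stepFun ε (1 / 4) t * k t + μ * (1 - k t)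
  have hF : ContinuousOn F (spectrum ℝ w) := by fun_prop
  have hbump : cfc (bump ε) (cfc F w) = cfc k w := by
    rw [← cfc_comp (bump ε) F w hw (continuous_bump ε).continuousOn hF]
    refine cfc_congr fun t ht => ?_
    rcases h₃ ht with h | h
    · simp only [Function.comp, F, hk1 (le_of_lt h)]
      rw [bump_eq_one]
      simp only [mul_one, sub_self, mul_zero, add_zero]
      rw [stepFun, sin_quarter hε]
      norm_num
    · simp only [Function.comp, F, hk0 (le_of_lt h)]
      rw [bump_eq_zero]
      simp [hμ]
  refine ⟨cfc F w, cfc_predicate _ _, ?_, ?_, ?_⟩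
  · obtain ⟨s, hs, hs'⟩ := χ.exists_real_eq hw
    rw [χ.apply_cfc hw hs hF]
    have h4 : χ (w - v) = (s - (M + 3) : ℝ) := by
      rw [map_sub, hs, hvdef, map_add, map_mul, hχp, smul_sub, map_sub, hχ1, ← Complex.coe_smul,
        map_smul, hχp]
      simp
    have h5 : |s - (M + 3)| < 1 := by
      rw [← Real.norm_eq_abs, ← Complex.norm_real, ← h4]
      exact (NonUnitalStarAlgHom.norm_apply_le χ _).trans_lt hwv.2.2
    simp [F, hk0 (show M + 2 ≤ s by linarith [(abs_lt.1 h5).1])]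
  · have h4 : ‖cfc F w - cfc f₀ w‖ ≤ ε := by
      rw [← cfc_sub F f₀ w hF hf₀.continuousOn]
      refine norm_cfc_le hε.le fun t _ => ?_
      rw [show F t - f₀ t = (stepFun ε (1 / 4) t - t) * k t by simp only [F, f₀]; ring,
        norm_mul]
      exact (mul_le_of_le_one_right (norm_nonneg _) (hkb t)).trans
        (abs_stepFun_sub_le hε (by norm_num) (by norm_num) t)
    have h5 : ‖cfc f₀ v - x‖ ≤ 3 * ε := by
      have : cfc f₀ v - x = (μ - r) • (1 : P) - ((x - r • 1) - p * (x - r • 1) * p) := by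
        rw [hfv, hadef]
        simp only [mul_add, add_mul, mul_sub, sub_mul, mul_smul_comm, smul_mul_assoc, mul_one,
          hpp]
        module
      rw [this]
      refine (norm_sub_le _ _).trans ?_
      have h6 : ‖(μ - r) • (1 : P)‖ ≤ 2 * ε := by
        rw [norm_smul]
        exact (mul_le_of_le_one_right (norm_nonneg _)
          (IsStarProjection.one P).norm_le_one').trans hμr
      linarith
    calc ‖cfc F w - x‖ = ‖(cfc F w - cfc f₀ w) + (cfc f₀ w - cfc f₀ v) + (cfc f₀ v - x)‖ := by
          congr 1; abel
      _ ≤ _ := (norm_add₃_le).trans (by linarith)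
  · rw [hbump]
    set q := cfc k w
    have hq : ‖q‖ ≤ 1 := norm_cfc_le zero_le_one fun t _ => hkb t
    have h4 := norm_mul_mul_sub_le c hp.norm_le_one' hq
    have h6 : ‖q - p‖ * ‖c‖ ≤ η / 4 := by
      rw [hkv] at h₂
      have h7 : ‖q - p‖ * (4 * (‖c‖ + 1)) ≤ η :=
        ((lt_div_iff₀ (by positivity)).1 h₂).le
      nlinarith [norm_nonneg (q - p)]
    have := norm_sub_le (c - p * c * p) (q * c * q - p * c * p)
    rw [sub_sub_sub_cancel_right] at this
    linarith

end Characters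

/-! ### Generating tuples: stability, openness and images under homomorphisms -/

section Generation

open scoped CStarAlgebra

section Basic

variable {A : Type*} [NonUnitalCStarAlgebra A]

theorem isClosed_cstarGenerated {k : ℕ} (a : Fin k → A) :
    IsClosed (cstarGenerated A a : Set A) :=
  NonUnitalStarSubalgebra.isClosed_topologicalClosure _

theorem mem_cstarGenerated {k : ℕ} (a : Fin k → A) (i : Fin k) : a i ∈ cstarGenerated A a :=
  NonUnitalStarSubalgebra.le_topologicalClosure _
    (NonUnitalStarAlgebra.subset_adjoin ℂ _ (Set.mem_range_self i))

theorem cstarGenerated_le {k : ℕ} {a : Fin k → A} {S : NonUnitalStarSubalgebra ℂ A}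
    (hS : IsClosed (S : Set A)) (h : ∀ i, a i ∈ S) : cstarGenerated A a ≤ S :=
  NonUnitalStarSubalgebra.topologicalClosure_minimal _
    (NonUnitalStarAlgebra.adjoin_le (Set.range_subset_iff.2 h)) hS

theorem exists_mem_norm_sub_lt_of_generates {k : ℕ} {a : Fin k → A}
    (ha : cstarGenerated A a = ⊤) (S : NonUnitalStarSubalgebra ℂ A) (h : ∀ i, a i ∈ S) (x : A)
    {ε : ℝ} (hε : 0 < ε) : ∃ y ∈ S, ‖y - x‖ < ε := by
  have h1 : cstarGenerated A a ≤ S.topologicalClosure :=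
    cstarGenerated_le (NonUnitalStarSubalgebra.isClosed_topologicalClosure _)
      fun i => NonUnitalStarSubalgebra.le_topologicalClosure _ (h i)
  rw [ha] at h1
  have h2 : x ∈ closure (S : Set A) := h1 trivial
  obtain ⟨y, hy, hxy⟩ := Metric.mem_closure_iff.1 h2 ε hε
  exact ⟨y, hy, by rwa [← dist_eq_norm, dist_comm]⟩

theorem mem_of_forall_exists_norm_sub_lt {S : NonUnitalStarSubalgebra ℂ A}
    (hS : IsClosed (S : Set A)) {x : A} (h : ∀ ε > 0, ∃ y ∈ S, ‖y - x‖ < ε) : x ∈ S := by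
  rw [← SetLike.mem_coe, ← hS.closure_eq]
  refine Metric.mem_closure_iff.2 fun ε hε => ?_
  obtain ⟨y, hy, hyx⟩ := h ε hε
  exact ⟨y, hy, by rwa [dist_comm, dist_eq_norm]⟩

theorem dense_genSA_succ {k : ℕ} (h : Dense (GenSA A k)) : Dense (GenSA A (k + 1)) := by
  intro z
  refine Metric.mem_closure_iff.2 fun ε hε => ?_
  obtain ⟨a, ha, hza⟩ := h.exists_dist_lt (fun i => z (Fin.castSucc i)) hε
  refine ⟨Fin.snoc a (z (Fin.last k)), ?_, (dist_pi_lt_iff hε).2 fun i => ?_⟩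
  · refine top_le_iff.1 (le_trans (top_le_iff.2 ha) ?_)
    refine cstarGenerated_le (isClosed_cstarGenerated _) fun i => ?_
    have := mem_cstarGenerated (fun j => ((Fin.snoc a (z (Fin.last k)) : Fin (k + 1) →
      selfAdjoint A) j : A)) i.castSucc
    simpa using this
  · refine Fin.lastCases ?_ (fun j => ?_) i
    · simpa using hε
    · simpa using (dist_pi_lt_iff hε).1 hza j

theorem dense_genSA_mono {k l : ℕ} (hkl : k ≤ l) (h : Dense (GenSA A k)) : Dense (GenSA A l) := by
  induction l, hkl using Nat.le_induction with
  | base => exact h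
  | succ n _ ih => exact dense_genSA_succ ih

variable (A) in
theorem unitalGeneratorRank_le_iff (n : ℕ) :
    unitalGeneratorRank A ≤ n ↔ Dense (GenSA A (n + 1)) := by
  refine ⟨fun h => ?_, fun h => iInf₂_le n h⟩
  by_contra hn
  have : ((n + 1 : ℕ) : ℕ∞) ≤ unitalGeneratorRank A := by
    refine le_iInf₂ fun k hk => Nat.cast_le.2 ?_
    by_contra hkn
    exact hn (dense_genSA_mono (by omega) hk)
  have h2 := this.trans h
  rw [Nat.cast_le] at h2
  omega

/-- The tuples whose generated sub-C*-algebra is at distance less than `δ` from `c`. -/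
def nearGenSA (k : ℕ) (c : A) (δ : ℝ) : Set (Fin k → selfAdjoint A) :=
  {z | ∃ w ∈ cstarGenerated A (fun i => (z i : A)), ‖w - c‖ < δ}

/-- An element of the algebraic adjoin is a star-polynomial in the entries, which can be evaluated
at nearby tuples. This gives openness of `nearGenSA`. -/
theorem exists_continuous_section_of_mem_adjoin {k : ℕ} (z : Fin k → selfAdjoint A) {w : A}
    (hw : w ∈ NonUnitalStarAlgebra.adjoin ℂ (Set.range fun i => (z i : A))) :
    ∃ F : (Fin k → selfAdjoint A) → A, Continuous F ∧
      (∀ y, F y ∈ cstarGenerated A (fun i => (y i : A))) ∧ F z = w := by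
  induction hw using NonUnitalStarAlgebra.adjoin_induction with
  | mem x hx =>
    obtain ⟨i, rfl⟩ := hx
    exact ⟨fun y => y i, by fun_prop, fun y => mem_cstarGenerated _ i, rfl⟩
  | add x y _ _ hx hy =>
    obtain ⟨F, hF, hF', rfl⟩ := hx
    obtain ⟨G, hG, hG', rfl⟩ := hy
    exact ⟨F + G, hF.add hG, fun y => add_mem (hF' y) (hG' y), rfl⟩
  | zero => exact ⟨0, continuous_zero, fun y => zero_mem _, rfl⟩
  | mul x y _ _ hx hy =>
    obtain ⟨F, hF, hF', rfl⟩ := hx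
    obtain ⟨G, hG, hG', rfl⟩ := hy
    exact ⟨F * G, hF.mul hG, fun y => mul_mem (hF' y) (hG' y), rfl⟩
  | smul r x _ hx =>
    obtain ⟨F, hF, hF', rfl⟩ := hx
    exact ⟨r • F, hF.const_smul r, fun y => SMulMemClass.smul_mem r (hF' y), rfl⟩
  | star x _ hx =>
    obtain ⟨F, hF, hF', rfl⟩ := hx
    exact ⟨star F, hF.star, fun y => star_mem (hF' y), rfl⟩

theorem isOpen_nearGenSA (k : ℕ) (c : A) (δ : ℝ) : IsOpen (nearGenSA k c δ) := by
  rw [isOpen_iff_mem_nhds]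
  rintro z ⟨w, hw, hwc⟩
  obtain ⟨v, hv, hwv⟩ := Metric.mem_closure_iff.1
    (show w ∈ closure (NonUnitalStarAlgebra.adjoin ℂ (Set.range fun i => (z i : A)) : Set A)
      from hw) (δ - ‖w - c‖) (sub_pos.2 hwc)
  obtain ⟨F, hF, hF', rfl⟩ := exists_continuous_section_of_mem_adjoin z hv
  have h1 : ‖F z - c‖ < δ := by
    rw [dist_eq_norm, norm_sub_rev] at hwv
    linarith [norm_sub_le_norm_sub_add_norm_sub (F z) w c]
  filter_upwards [(hF.sub continuous_const).norm.continuousAt.eventually (gt_mem_nhds h1)] with y hy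
  exact ⟨F y, hF' y, hy⟩

theorem genSA_subset_nearGenSA (k : ℕ) (c : A) {δ : ℝ} (hδ : 0 < δ) :
    GenSA A k ⊆ nearGenSA k c δ := fun z hz =>
  ⟨c, by rw [show cstarGenerated A (fun i => (z i : A)) = ⊤ from hz]; trivial, by simpa⟩

end Basic

section Hom

variable {E P Q : Type*} [CStarAlgebra E] [CStarAlgebra P] [CStarAlgebra Q]

/-- The map induced by a star homomorphism between the self-adjoint parts. -/
def StarAlgHom.mapSelfAdjoint (f : E →⋆ₐ[ℂ] P) (a : selfAdjoint E) : selfAdjoint P :=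
  ⟨f a, a.2.map f⟩

@[simp]
theorem StarAlgHom.coe_mapSelfAdjoint (f : E →⋆ₐ[ℂ] P) (a : selfAdjoint E) :
    (f.mapSelfAdjoint a : P) = f a := rfl

theorem StarAlgHom.continuous_mapSelfAdjoint (f : E →⋆ₐ[ℂ] P) : Continuous f.mapSelfAdjoint :=
  ((map_continuous f).comp continuous_subtype_val).subtype_mk _

theorem StarAlgHom.map_coe_realPart (f : E →⋆ₐ[ℂ] P) (u : E) :
    f (realPart u : E) = (realPart (f u) : P) := by
  rw [realPart_apply_coe, realPart_apply_coe, ← Complex.coe_smul, ← Complex.coe_smul]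
  simp [map_star]

theorem StarAlgHom.surjective_mapSelfAdjoint {f : E →⋆ₐ[ℂ] P} (hf : Function.Surjective f) :
    Function.Surjective f.mapSelfAdjoint := by
  intro b
  obtain ⟨u, hu⟩ := hf b
  refine ⟨realPart u, Subtype.ext ?_⟩
  rw [StarAlgHom.coe_mapSelfAdjoint, StarAlgHom.map_coe_realPart, hu]
  exact b.2.coe_realPart

/-- The open mapping theorem applies to `f`; taking real parts retracts onto the self-adjoint parts
and commutes with `f`. -/
theorem StarAlgHom.isOpenMap_mapSelfAdjoint {f : E →⋆ₐ[ℂ] P} (hf : Function.Surjective f) :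
    IsOpenMap f.mapSelfAdjoint := by
  let φ : E →L[ℂ] P := ⟨f.toAlgHom.toLinearMap, map_continuous f⟩
  have hφ : IsOpenMap f := φ.isOpenMap hf
  intro U hU
  have hre : Continuous (fun u : E => (realPart u : selfAdjoint E)) := by
    refine continuous_induced_rng.2 ?_
    simp only [Function.comp_def, realPart_apply_coe]
    fun_prop
  have : f.mapSelfAdjoint '' U =
      ((↑) : selfAdjoint P → P) ⁻¹' (f '' ((fun u : E => (realPart u : selfAdjoint E)) ⁻¹' U)) := by
    ext b
    constructor
    · rintro ⟨a, ha, rfl⟩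
      refine ⟨a, ?_, rfl⟩
      have : realPart (a : E) = a := Subtype.ext a.2.coe_realPart
      simpa [this] using ha
    · rintro ⟨u, hu, hub⟩
      refine ⟨realPart u, hu, Subtype.ext ?_⟩
      rw [StarAlgHom.coe_mapSelfAdjoint, StarAlgHom.map_coe_realPart, hub]
      exact b.2.coe_realPart
  rw [this]
  exact (hφ _ (hU.preimage hre)).preimage continuous_subtype_val

theorem StarAlgHom.map_mem_cstarGenerated (f : E →⋆ₐ[ℂ] P) {k : ℕ} {z : Fin k → E} {w : E}
    (hw : w ∈ cstarGenerated E z) : f w ∈ cstarGenerated P (fun i => f (z i)) := by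
  have h := cstarGenerated_le (a := z)
    (S := (cstarGenerated P (fun i => f (z i))).comap (f : E →⋆ₙₐ[ℂ] P))
    ((isClosed_cstarGenerated _).preimage (map_continuous f))
    (fun i => mem_cstarGenerated (fun i => f (z i)) i)
  exact h hw

theorem dense_genSA_of_surjective {f : E →⋆ₐ[ℂ] P} (hf : Function.Surjective f) {k : ℕ}
    (h : Dense (GenSA E k)) : Dense (GenSA P k) := by
  have hs : Function.Surjective fun (z : Fin k → selfAdjoint E) i => f.mapSelfAdjoint (z i) :=
    (StarAlgHom.surjective_mapSelfAdjoint hf).comp_left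
  have hc : Continuous fun (z : Fin k → selfAdjoint E) i => f.mapSelfAdjoint (z i) :=
    continuous_pi fun i => f.continuous_mapSelfAdjoint.comp (continuous_apply i)
  refine (hs.denseRange.dense_image hc h).mono ?_
  rintro _ ⟨z, hz, rfl⟩
  refine top_le_iff.1 fun u _ => ?_
  obtain ⟨t, rfl⟩ := hf u
  refine f.map_mem_cstarGenerated ?_
  rw [show cstarGenerated E (fun i => (z i : E)) = ⊤ from hz]
  trivial

theorem exists_mem_cstarGenerated_norm_map_sub_lt (f : E →⋆ₐ[ℂ] P) {k : ℕ} {z : Fin k → E}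
    (h : cstarGenerated P (fun i => f (z i)) = ⊤) (u : P) {ε : ℝ} (hε : 0 < ε) :
    ∃ w ∈ cstarGenerated E z, ‖f w - u‖ < ε := by
  obtain ⟨_, ⟨w, hw, rfl⟩, h1⟩ := exists_mem_norm_sub_lt_of_generates h
    ((cstarGenerated E z).map (f : E →⋆ₙₐ[ℂ] P))
    (fun i => ⟨z i, mem_cstarGenerated z i, rfl⟩) u hε
  exact ⟨w, hw, h1⟩

theorem norm_eq_max_of_jointly_injective (f : E →⋆ₐ[ℂ] P) (g : E →⋆ₐ[ℂ] Q)
    (hinj : ∀ z, f z = 0 → g z = 0 → z = 0) (z : E) : ‖z‖ = max ‖f z‖ ‖g z‖ := by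
  have h : Function.Injective (f.prod g) := by
    rw [injective_iff_map_eq_zero]
    intro z hz
    exact hinj z (congrArg Prod.fst hz) (congrArg Prod.snd hz)
  rw [← NonUnitalStarAlgHom.norm_map (f.prod g) h z]
  rfl

theorem isSelfAdjoint_of_jointly_injective {f : E →⋆ₐ[ℂ] P} {g : E →⋆ₐ[ℂ] Q}
    (hinj : ∀ z, f z = 0 → g z = 0 → z = 0) {z : E} (hf : IsSelfAdjoint (f z))
    (hg : IsSelfAdjoint (g z)) : IsSelfAdjoint z := by
  rw [isSelfAdjoint_iff, ← sub_eq_zero]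
  exact hinj _ (by rw [map_sub, map_star, hf.star_eq, sub_self])
    (by rw [map_sub, map_star, hg.star_eq, sub_self])

theorem cfcₙ_mem_cstarGenerated {k : ℕ} (z : Fin k → E) (h : ℝ → ℝ) (i : Fin k) :
    cfcₙ h (z i) ∈ cstarGenerated E z :=
  haveI : IsClosed (cstarGenerated E z : Set E) := isClosed_cstarGenerated z
  cfcₙ_mem h (mem_cstarGenerated z i)

theorem StarAlgHom.map_cfcₙ_eq_cfc (f : E →⋆ₐ[ℂ] P) {z : E} (hz : IsSelfAdjoint z) {h : ℝ → ℝ}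
    (hh : Continuous h) (h0 : h 0 = 0) : f (cfcₙ h z) = cfc h (f z) := by
  rw [cfcₙ_eq_cfc hh.continuousOn h0,
    StarAlgHomClass.map_cfc f h z hh.continuousOn (map_continuous f) hz (hz.map f)]

end Hom

end Generation

/-! ### Density of generating tuples in direct sums and pullbacks -/

section Products

open scoped CStarAlgebra

variable {E P Q : Type*} [CStarAlgebra E] [CStarAlgebra P] [CStarAlgebra Q]

theorem selfAdjoint.norm_sub_lt_of_dist_lt {k : ℕ} {x y : Fin k → selfAdjoint P} {θ : ℝ}
    (hθ : 0 < θ) (h : dist x y < θ) (i : Fin k) : ‖(y i : P) - x i‖ < θ := by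
  have := (dist_pi_lt_iff hθ).1 h i
  rwa [dist_comm, dist_eq_norm] at this

theorem norm_update_sub_le {k : ℕ} (x : Fin (k + 1) → selfAdjoint P) (a : selfAdjoint P) {M : ℝ}
    (h : ‖(a : P) - x 0‖ ≤ M) (i : Fin (k + 1)) :
    ‖((Function.update x 0 a i : selfAdjoint P) : P) - x i‖ ≤ M := by
  by_cases hi : i = 0
  · subst hi; simpa using h
  · simpa [Function.update_of_ne hi] using (norm_nonneg _).trans h

theorem isOpen_sin_gt (ε : ℝ) : IsOpen {t : ℝ | 1 / 2 < Real.sin (2 * Real.pi * (t / ε))} :=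
  isOpen_lt continuous_const (by fun_prop)

theorem isOpen_sin_lt (ε : ℝ) : IsOpen {t : ℝ | Real.sin (2 * Real.pi * (t / ε)) < 0} :=
  isOpen_lt (by fun_prop) continuous_const

theorem cfc_bump_eq_one {x : P} (hx : IsSelfAdjoint x) {ε : ℝ}
    (h : spectrum ℝ x ⊆ {t : ℝ | 1 / 2 < Real.sin (2 * Real.pi * (t / ε))}) :
    cfc (bump ε) x = 1 := by
  rw [← cfc_const_one ℝ x]
  exact cfc_congr fun t ht => bump_eq_one (le_of_lt (h ht))

theorem cfc_bump_eq_zero {x : P} {ε : ℝ}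
    (h : spectrum ℝ x ⊆ {t : ℝ | Real.sin (2 * Real.pi * (t / ε)) < 0}) :
    cfc (bump ε) x = 0 := by
  rw [← cfc_const_zero ℝ x]
  exact cfc_congr fun t ht => bump_eq_zero (le_of_lt (h ht))

/-- Density of generating tuples in the direct sum of two unital C*-algebras of real rank zero. -/
theorem dense_genSA_of_prod (f : E →⋆ₐ[ℂ] P) (g : E →⋆ₐ[ℂ] Q)
    (hinj : ∀ z, f z = 0 → g z = 0 → z = 0) (hsurj : ∀ x y, ∃ z, f z = x ∧ g z = y)
    (hP : Dense {a : selfAdjoint P | IsUnit (a : P)})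
    (hQ : Dense {a : selfAdjoint Q | IsUnit (a : Q)}) {k : ℕ}
    (hgP : Dense (GenSA P (k + 1))) (hgQ : Dense (GenSA Q (k + 1))) :
    Dense (GenSA E (k + 1)) := by
  have hnorm := norm_eq_max_of_jointly_injective f g hinj
  intro z
  refine Metric.mem_closure_iff.2 fun δ hδ => ?_
  set ε : ℝ := δ / 8 with hεdef
  have hε : 0 < ε := by positivity
  obtain ⟨x₀, hx₀, hxd, hxs⟩ := exists_near_spectrum_subset_progression hP
    ((z 0).2.map f) (θ := 1 / 4) hε (by norm_num) (by norm_num)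
  obtain ⟨y₀, hy₀, hyd, hys⟩ := exists_near_spectrum_subset_progression hQ
    ((z 0).2.map g) (θ := 3 / 4) hε (by norm_num) (by norm_num)
  obtain ⟨η₁, hη₁, h₁⟩ := exists_forall_spectrum_subset (isOpen_sin_gt ε) (a := x₀) (by
    intro t ht
    obtain ⟨j, rfl⟩ := hxs t ht
    rw [Set.mem_ofPred_eq, sin_quarter hε]
    norm_num)
  obtain ⟨η₂, hη₂, h₂⟩ := exists_forall_spectrum_subset (isOpen_sin_lt ε) (a := y₀) (by
    intro t ht
    obtain ⟨j, rfl⟩ := hys t ht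
    rw [Set.mem_ofPred_eq, sin_three_quarters hε]
    norm_num)
  obtain ⟨X, hX, hXd⟩ := hgP.exists_dist_lt
    (Function.update (fun i => f.mapSelfAdjoint (z i)) 0 ⟨x₀, hx₀⟩) (lt_min hη₁ hε)
  obtain ⟨Y, hY, hYd⟩ := hgQ.exists_dist_lt
    (Function.update (fun i => g.mapSelfAdjoint (z i)) 0 ⟨y₀, hy₀⟩) (lt_min hη₂ hε)
  replace hXd := selfAdjoint.norm_sub_lt_of_dist_lt (lt_min hη₁ hε) hXd
  replace hYd := selfAdjoint.norm_sub_lt_of_dist_lt (lt_min hη₂ hε) hYd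
  have hXs := h₁ (X 0) (by simpa using (hXd 0).trans_le (min_le_left _ _))
  have hYs := h₂ (Y 0) (by simpa using (hYd 0).trans_le (min_le_left _ _))
  choose z' hfz hgz using fun i => hsurj (X i : P) (Y i : Q)
  have hz' (i) : IsSelfAdjoint (z' i) := isSelfAdjoint_of_jointly_injective hinj
    (by rw [hfz]; exact (X i).2) (by rw [hgz]; exact (Y i).2)
  refine ⟨fun i => ⟨z' i, hz' i⟩, ?_, (dist_pi_lt_iff hδ).2 fun i => ?_⟩
  · have hfX : cstarGenerated P (fun i => f (z' i)) = ⊤ := by simp only [hfz]; exact hX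
    have hgY : cstarGenerated Q (fun i => g (z' i)) = ⊤ := by simp only [hgz]; exact hY
    -- This cutoff has coordinates `(1, 0)`; multiplying by it splices approximants `u` and `v`
    -- found separately in the two coordinates.
    have he := cfcₙ_mem_cstarGenerated z' (bump ε) 0
    have hfe : f (cfcₙ (bump ε) (z' 0)) = 1 := by
      rw [f.map_cfcₙ_eq_cfc (hz' 0) (continuous_bump ε) (bump_zero ε), hfz,
        cfc_bump_eq_one (X 0).2 hXs]
    have hge : g (cfcₙ (bump ε) (z' 0)) = 0 := by
      rw [g.map_cfcₙ_eq_cfc (hz' 0) (continuous_bump ε) (bump_zero ε), hgz,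
        cfc_bump_eq_zero hYs]
    set e := cfcₙ (bump ε) (z' 0)
    change cstarGenerated E z' = ⊤
    refine top_le_iff.1 fun t _ => mem_of_forall_exists_norm_sub_lt (isClosed_cstarGenerated _)
      fun τ hτ => ?_
    obtain ⟨u, hu, hut⟩ := exists_mem_cstarGenerated_norm_map_sub_lt f hfX (f t) hτ
    obtain ⟨v, hv, hvt⟩ := exists_mem_cstarGenerated_norm_map_sub_lt g hgY (g t) hτ
    refine ⟨e * u + (v - e * v), add_mem (mul_mem he hu) (sub_mem hv (mul_mem he hv)), ?_⟩
    rw [hnorm]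
    exact max_lt (by simpa [hfe] using hut) (by simpa [hge] using hvt)
  · rw [dist_comm, dist_eq_norm]
    change ‖z' i - z i‖ < δ
    rw [hnorm, map_sub, map_sub, hfz, hgz]
    have h3 := norm_update_sub_le (fun i => f.mapSelfAdjoint (z i)) ⟨x₀, hx₀⟩ (M := 2 * ε) hxd i
    have h4 := norm_update_sub_le (fun i => g.mapSelfAdjoint (z i)) ⟨y₀, hy₀⟩ (M := 2 * ε) hyd i
    have h5 := (hXd i).trans_le (min_le_right _ _)
    have h6 := (hYd i).trans_le (min_le_right _ _)
    rw [StarAlgHom.coe_mapSelfAdjoint] at h3 h4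
    refine max_lt ?_ ?_
    · have := norm_sub_le_norm_sub_add_norm_sub (X i : P)
        ((Function.update (fun i => f.mapSelfAdjoint (z i)) 0 ⟨x₀, hx₀⟩ i : selfAdjoint P) : P)
        (f (z i))
      linarith
    · have := norm_sub_le_norm_sub_add_norm_sub (Y i : Q)
        ((Function.update (fun i => g.mapSelfAdjoint (z i)) 0 ⟨y₀, hy₀⟩ i : selfAdjoint Q) : Q)
        (g (z i))
      linarith

/-- In the pullback of two unital C*-algebras of real rank zero along characters, every element
supported in the first coordinate is almost contained in the sub-C*-algebra generated by a generic
tuple. -/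
theorem dense_nearGenSA_of_pullback (f : E →⋆ₐ[ℂ] P) (g : E →⋆ₐ[ℂ] Q)
    (χ : P →⋆ₐ[ℂ] ℂ) (ψ : Q →⋆ₐ[ℂ] ℂ)
    (hinj : ∀ z, f z = 0 → g z = 0 → z = 0) (hχψ : ∀ z, χ (f z) = ψ (g z))
    (hpull : ∀ x y, χ x = ψ y → ∃ z, f z = x ∧ g z = y)
    (hP : Dense {a : selfAdjoint P | IsUnit (a : P)})
    (hQ : Dense {a : selfAdjoint Q | IsUnit (a : Q)}) {k : ℕ}
    (hgP : Dense (GenSA P (k + 1))) {c : E} (hc : IsSelfAdjoint (f c)) (hgc : g c = 0)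
    {τ : ℝ} (hτ : 0 < τ) :
    Dense (nearGenSA (k + 1) c τ) := by
  have hnorm := norm_eq_max_of_jointly_injective f g hinj
  have hψ1 (s : ℝ) : ψ (s • (1 : Q)) = s := by
    rw [← Complex.coe_smul, map_smul, map_one]; simp
  intro z
  refine Metric.mem_closure_iff.2 fun δ hδ => ?_
  set ε : ℝ := δ / 20 with hεdef
  have hε : 0 < ε := by positivity
  obtain ⟨y₀, hy₀, hyd, hys⟩ := exists_near_spectrum_subset_progression hQ
    ((z 0).2.map g) (θ := 3 / 4) hε (by norm_num) (by norm_num)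
  obtain ⟨η₂, hη₂, h₂⟩ := exists_forall_spectrum_subset (isOpen_sin_lt ε) (a := y₀) (by
    intro t ht
    obtain ⟨j, rfl⟩ := hys t ht
    rw [Set.mem_ofPred_eq, sin_three_quarters hε]
    norm_num)
  obtain ⟨μ, hμ, hμs⟩ := ψ.exists_real_eq hy₀
  have hμsin : Real.sin (2 * Real.pi * (μ / ε)) = -1 := by
    obtain ⟨j, rfl⟩ := hys μ hμs
    exact sin_three_quarters hε j
  obtain ⟨r, hr, -⟩ := χ.exists_real_eq ((z 0).2.map f)
  have hμr : |μ - r| ≤ 2 * ε := by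
    rw [← Real.norm_eq_abs, ← Complex.norm_real, Complex.ofReal_sub, ← hμ, ← hr, hχψ, ← map_sub]
    exact (NonUnitalStarAlgHom.norm_apply_le ψ _).trans hyd
  obtain ⟨x₀, hx₀, hχx, hxd, hxc⟩ := exists_near_norm_sub_bump_le hP χ ((z 0).2.map f) hc
    (by rw [hχψ, hgc, map_zero]) hε hr hμr hμsin (show 0 < τ / 4 by positivity)
  obtain ⟨η₁, hη₁, h₁⟩ := exists_forall_norm_cfc_sub_lt (continuous_bump ε) hx₀
    (show 0 < τ / (8 * (‖f c‖ + 1)) by positivity)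
  set x' : Fin (k + 1) → selfAdjoint P :=
    Function.update (fun i => f.mapSelfAdjoint (z i)) 0 ⟨x₀, hx₀⟩ with hx'
  set y' : Fin (k + 1) → selfAdjoint Q :=
    Function.update (fun i => g.mapSelfAdjoint (z i)) 0 ⟨y₀, hy₀⟩ with hy'
  have hx'0 : (x' 0 : P) = x₀ := by simp [hx']
  have hy'0 : (y' 0 : Q) = y₀ := by simp [hy']
  have hxy' (i) : χ (x' i) = ψ (y' i) := by
    by_cases hi : i = 0
    · subst hi; rw [hx'0, hy'0, hχx, hμ]
    · simp [hx', hy', Function.update_of_ne hi, hχψ]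
  have hθ : 0 < min (min η₁ η₂) ε := by positivity
  obtain ⟨X, hX, hXd⟩ := hgP.exists_dist_lt x' hθ
  replace hXd := selfAdjoint.norm_sub_lt_of_dist_lt hθ hXd
  -- Passing to the generating tuple `X` moves the values at `χ`; scalar shifts of the second
  -- coordinate by `s i` restore the match. The shifted tuple need not generate `Q`: only `c` has to
  -- be approximated.
  choose s hs hs' using fun i => χ.exists_real_eq ((X i - x' i).2)
  have hsd (i) : ‖s i • (1 : Q)‖ ≤ ‖(X i : P) - x' i‖ := by
    rw [norm_smul]
    refine (mul_le_of_le_one_right (norm_nonneg _) (IsStarProjection.one Q).norm_le_one').trans ?_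
    rw [← Complex.norm_real, ← hs]
    exact NonUnitalStarAlgHom.norm_apply_le χ _
  let Y : Fin (k + 1) → Q := fun i => y' i + s i • (1 : Q)
  have hYsa (i) : IsSelfAdjoint (Y i) :=
    (y' i).2.add ((IsSelfAdjoint.all (s i)).smul (IsSelfAdjoint.one Q))
  have hXY (i) : χ (X i) = ψ (Y i) := by
    rw [map_add, hψ1, ← hs, ← hxy', ← map_add]
    simp
  have hYs : spectrum ℝ (Y 0) ⊆ {t : ℝ | Real.sin (2 * Real.pi * (t / ε)) < 0} := by
    refine h₂ _ ?_
    have : Y 0 - y₀ = s 0 • (1 : Q) := by simp only [Y, hy'0]; abel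
    rw [this]
    exact (hsd 0).trans_lt ((hXd 0).trans_le ((min_le_left _ _).trans (min_le_right _ _)))
  choose z' hfz hgz using fun i => hpull (X i : P) (Y i) (hXY i)
  have hz' (i) : IsSelfAdjoint (z' i) := isSelfAdjoint_of_jointly_injective hinj
    (by rw [hfz]; exact (X i).2) (by rw [hgz]; exact hYsa i)
  refine ⟨fun i => ⟨z' i, hz' i⟩, ?_, (dist_pi_lt_iff hδ).2 fun i => ?_⟩
  · have hfX : cstarGenerated P (fun i => f (z' i)) = ⊤ := by simp only [hfz]; exact hX
    have he := cfcₙ_mem_cstarGenerated z' (bump ε) 0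
    have hfe : f (cfcₙ (bump ε) (z' 0)) = cfc (bump ε) (X 0 : P) := by
      rw [f.map_cfcₙ_eq_cfc (hz' 0) (continuous_bump ε) (bump_zero ε), hfz]
    have hge : g (cfcₙ (bump ε) (z' 0)) = 0 := by
      rw [g.map_cfcₙ_eq_cfc (hz' 0) (continuous_bump ε) (bump_zero ε), hgz,
        cfc_bump_eq_zero hYs]
    set e := cfcₙ (bump ε) (z' 0)
    set q := cfc (bump ε) (X 0 : P)
    have hq : ‖q‖ ≤ 1 := norm_cfc_le zero_le_one fun t _ => abs_bump_le_one ε t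
    have hp : ‖cfc (bump ε) x₀‖ ≤ 1 := norm_cfc_le zero_le_one fun t _ => abs_bump_le_one ε t
    obtain ⟨w, hw, hwc⟩ := exists_mem_cstarGenerated_norm_map_sub_lt f hfX (f c)
      (show 0 < τ / 4 by positivity)
    -- Only `f w` is known to approximate `f c`; the factors `e` kill the second coordinate of `w`
    -- and almost fix `c`. The three errors are at most `τ / 4` each.
    refine ⟨e * w * e, mul_mem (mul_mem he hw) he, ?_⟩
    have h3 : ‖q - cfc (bump ε) x₀‖ * ‖f c‖ ≤ τ / 8 := by
      have h4 := h₁ (X 0) (X 0).2 (by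
        rw [← hx'0]
        exact (hXd 0).trans_le ((min_le_left _ _).trans (min_le_left _ _)))
      have h5 : ‖q - cfc (bump ε) x₀‖ * (8 * (‖f c‖ + 1)) ≤ τ :=
        ((lt_div_iff₀ (by positivity)).1 h4).le
      nlinarith [norm_nonneg (q - cfc (bump ε) x₀)]
    have h4 := norm_mul_mul_sub_le (f c) hp hq
    have h5 : ‖q * (f w - f c) * q‖ ≤ ‖f w - f c‖ :=
      (norm_mul_le _ _).trans <| (mul_le_of_le_one_right (norm_nonneg _) hq).trans <|
        (norm_mul_le _ _).trans <| mul_le_of_le_one_left (norm_nonneg _) hq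
    rw [hnorm]
    refine max_lt ?_ (by simpa [hge, hgc] using hτ)
    have h6 : f (e * w * e - c) = q * (f w - f c) * q +
        (q * f c * q - cfc (bump ε) x₀ * f c * cfc (bump ε) x₀) -
        (f c - cfc (bump ε) x₀ * f c * cfc (bump ε) x₀) := by
      simp only [map_sub, map_mul, hfe, mul_sub, sub_mul]
      abel
    rw [h6]
    refine (norm_sub_le _ _).trans_lt ?_
    linarith [norm_add_le (q * (f w - f c) * q)
      (q * f c * q - cfc (bump ε) x₀ * f c * cfc (bump ε) x₀)]
  · rw [dist_comm, dist_eq_norm]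
    change ‖z' i - z i‖ < δ
    rw [hnorm, map_sub, map_sub, hfz, hgz]
    have h3 := norm_update_sub_le (fun i => f.mapSelfAdjoint (z i)) ⟨x₀, hx₀⟩ (M := 5 * ε) hxd i
    have h4 := norm_update_sub_le (fun i => g.mapSelfAdjoint (z i)) ⟨y₀, hy₀⟩ (M := 2 * ε) hyd i
    rw [StarAlgHom.coe_mapSelfAdjoint] at h3 h4
    have h5 := (hXd i).trans_le (min_le_right _ _)
    have h6 := hsd i
    refine max_lt ?_ ?_
    · have := norm_sub_le_norm_sub_add_norm_sub (X i : P) (x' i) (f (z i))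
      linarith
    · have := norm_add_le ((y' i : Q) - g (z i)) (s i • (1 : Q))
      rw [show (y' i : Q) - g (z i) + s i • (1 : Q) = Y i - g (z i) by simp only [Y]; abel] at this
      linarith

/-- Density of generating tuples in the pullback of two unital C*-algebras of real rank zero along
characters. -/
theorem dense_genSA_of_pullback (f : E →⋆ₐ[ℂ] P) (g : E →⋆ₐ[ℂ] Q)
    (χ : P →⋆ₐ[ℂ] ℂ) (ψ : Q →⋆ₐ[ℂ] ℂ)
    (hinj : ∀ z, f z = 0 → g z = 0 → z = 0) (hχψ : ∀ z, χ (f z) = ψ (g z))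
    (hpull : ∀ x y, χ x = ψ y → ∃ z, f z = x ∧ g z = y)
    (hP : Dense {a : selfAdjoint P | IsUnit (a : P)})
    (hQ : Dense {a : selfAdjoint Q | IsUnit (a : Q)}) {k : ℕ}
    (hgP : Dense (GenSA P (k + 1))) (hgQ : Dense (GenSA Q (k + 1))) :
    Dense (GenSA E (k + 1)) := by
  have hnorm := norm_eq_max_of_jointly_injective f g hinj
  have hχ1 (s : ℂ) : χ (s • (1 : P)) = s := by rw [map_smul, map_one]; simp
  have hsurj : Function.Surjective g := fun y => by
    obtain ⟨z, -, hz⟩ := hpull (ψ y • 1) y (hχ1 _)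
    exact ⟨z, hz⟩
  obtain ⟨x, hx⟩ := hgP.nonempty
  obtain ⟨y, hy⟩ := hgQ.nonempty
  -- Subtracting the scalar part puts the generators of `P` into the kernel of `χ`, so they lift to
  -- elements with second coordinate `0`.
  choose c hfc hgc using fun i => hpull (x i - χ (x i) • 1 : P) 0
    (by rw [map_sub, hχ1, sub_self, map_zero])
  have hfcsa (i) : IsSelfAdjoint (f (c i)) := by
    obtain ⟨r, hr, -⟩ := χ.exists_real_eq (x i).2
    rw [hfc, hr, Complex.coe_smul]
    exact (x i).2.sub ((IsSelfAdjoint.all r).smul (IsSelfAdjoint.one P))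
  let G : (Fin (k + 1) → selfAdjoint E) → (Fin (k + 1) → selfAdjoint Q) :=
    fun z i => g.mapSelfAdjoint (z i)
  have hG : Continuous G :=
    continuous_pi fun i => g.continuous_mapSelfAdjoint.comp (continuous_apply i)
  have hGo : IsOpenMap G :=
    IsOpenMap.piMap (fun _ => StarAlgHom.isOpenMap_mapSelfAdjoint hsurj)
      (.of_forall fun _ => StarAlgHom.surjective_mapSelfAdjoint hsurj)
  have hpos (m : ℕ) : (0 : ℝ) < 1 / (m + 1) := by positivity
  -- Countably many open dense conditions suffice: finitely many generators on each side, and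
  -- tolerances `1 / (m + 1)`.
  have h1 := dense_iInter_of_isOpen
    (f := fun n : Fin (k + 1) × ℕ => nearGenSA (k + 1) (c n.1) (1 / (n.2 + 1)))
    (fun n => isOpen_nearGenSA _ _ _) fun n => dense_nearGenSA_of_pullback f g χ ψ hinj hχψ
      hpull hP hQ hgP (hfcsa n.1) (hgc n.1) (hpos n.2)
  have h2o (n : Fin (k + 1) × ℕ) :
      IsOpen (G ⁻¹' nearGenSA (k + 1) (y n.1 : Q) (1 / (n.2 + 1))) :=
    (isOpen_nearGenSA _ _ _).preimage hG
  have h2 := dense_iInter_of_isOpen h2o fun n =>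
    (hgQ.mono (genSA_subset_nearGenSA _ _ (hpos n.2))).preimage hGo
  refine (Dense.inter_of_Gδ (.iInter_of_isOpen fun n => isOpen_nearGenSA _ _ _)
    (.iInter_of_isOpen h2o) h1 h2).mono ?_
  rintro z ⟨hz1, hz2⟩
  have hclosed := isClosed_cstarGenerated fun i => (z i : E)
  have hcC (i) : c i ∈ cstarGenerated E (fun i => (z i : E)) := by
    refine mem_of_forall_exists_norm_sub_lt hclosed fun τ hτ => ?_
    obtain ⟨m, hm⟩ := exists_nat_one_div_lt hτ
    obtain ⟨w, hw, hwc⟩ := Set.mem_iInter.1 hz1 (i, m)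
    exact ⟨w, hw, hwc.trans hm⟩
  have hgz : cstarGenerated Q (fun i => g (z i)) = ⊤ := by
    refine top_le_iff.1 ?_
    rw [← show cstarGenerated Q (fun i => (y i : Q)) = ⊤ from hy]
    refine cstarGenerated_le (isClosed_cstarGenerated _) fun i => ?_
    refine mem_of_forall_exists_norm_sub_lt (isClosed_cstarGenerated _) fun τ hτ => ?_
    obtain ⟨m, hm⟩ := exists_nat_one_div_lt hτ
    obtain ⟨w, hw, hwc⟩ := Set.mem_iInter.1 hz2 (i, m)
    exact ⟨w, hw, hwc.trans hm⟩
  -- `S` consists of the `u` whose part `u - χ u • 1`, lifted with second coordinate `0`, is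
  -- generated by `z`. It contains every `x i`, hence is dense in `P`. Closure under products uses
  -- that, for `u₀ = u - χ(u)` and `v₀ = v - χ(v)`, `uv - χ(uv) = u₀v₀ + χ(u)v₀ + χ(v)u₀`.
  let S : NonUnitalStarSubalgebra ℂ P :=
    { carrier := {u | ∃ w ∈ cstarGenerated E (fun i => (z i : E)), g w = 0 ∧ f w = u - χ u • 1}
      zero_mem' := ⟨0, zero_mem _, by simp, by simp⟩
      add_mem' := by
        rintro u v ⟨w, hw, hgw, hfw⟩ ⟨w', hw', hgw', hfw'⟩
        refine ⟨w + w', add_mem hw hw', by simp [hgw, hgw'], ?_⟩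
        rw [map_add, map_add, hfw, hfw', add_smul]
        abel
      mul_mem' := by
        rintro u v ⟨w, hw, hgw, hfw⟩ ⟨w', hw', hgw', hfw'⟩
        refine ⟨w * w' + χ u • w' + χ v • w, add_mem (add_mem (mul_mem hw hw')
          (SMulMemClass.smul_mem _ hw')) (SMulMemClass.smul_mem _ hw), by simp [hgw, hgw'], ?_⟩
        rw [map_add, map_add, map_mul, map_smul, map_smul, hfw, hfw', map_mul]
        simp only [mul_sub, sub_mul, mul_smul_comm, smul_mul_assoc, mul_one, one_mul]
        module
      smul_mem' := by
        rintro r u ⟨w, hw, hgw, hfw⟩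
        refine ⟨r • w, SMulMemClass.smul_mem _ hw, by simp [hgw], ?_⟩
        rw [map_smul, hfw, map_smul, smul_sub, smul_assoc]
      star_mem' := by
        rintro u ⟨w, hw, hgw, hfw⟩
        refine ⟨star w, star_mem hw, by simp [map_star, hgw], ?_⟩
        rw [map_star, hfw, map_star, star_sub, star_smul, star_one] }
  have hker (t : E) (ht : g t = 0) : t ∈ cstarGenerated E (fun i => (z i : E)) := by
    refine mem_of_forall_exists_norm_sub_lt hclosed fun τ hτ => ?_
    obtain ⟨u, ⟨w, hw, hgw, hfw⟩, hu⟩ := exists_mem_norm_sub_lt_of_generates hx S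
      (fun i => ⟨c i, hcC i, hgc i, hfc i⟩) (f t) (half_pos hτ)
    refine ⟨w, hw, ?_⟩
    have h3 : χ (f t) = 0 := by rw [hχψ, ht, map_zero]
    -- Removing the scalar part at most doubles the error, hence the tolerance `τ / 2` above.
    have h4 : f (w - t) = (u - f t) - χ (u - f t) • (1 : P) := by
      rw [map_sub, hfw, map_sub, h3, sub_zero]; abel
    rw [hnorm, h4]
    refine max_lt ((norm_sub_le _ _).trans_lt ?_) (by simpa [hgw, ht] using hτ)
    have h5 : ‖χ (u - f t) • (1 : P)‖ ≤ ‖u - f t‖ := by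
      rw [norm_smul]
      exact (mul_le_of_le_one_right (norm_nonneg _) (IsStarProjection.one P).norm_le_one').trans
        (NonUnitalStarAlgHom.norm_apply_le χ _)
    linarith
  change cstarGenerated E (fun i => (z i : E)) = ⊤
  refine top_le_iff.1 fun t _ => mem_of_forall_exists_norm_sub_lt hclosed fun τ hτ => ?_
  obtain ⟨w, hw, hwt⟩ := exists_mem_cstarGenerated_norm_map_sub_lt g hgz (g t) hτ
  -- A lift of `g w - g t` with scalar first coordinate has norm at most `‖g w - g t‖`. Then `w - t
  -- - s` lies in the kernel of `g`, so `t + s` is generated and close to `t`.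
  obtain ⟨s, hfs, hgs⟩ := hpull (ψ (g w - g t) • 1) (g w - g t) (hχ1 _)
  have h3 : w - t - s ∈ cstarGenerated E (fun i => (z i : E)) :=
    hker _ (by rw [map_sub, map_sub, hgs, sub_self])
  refine ⟨w - (w - t - s), sub_mem hw h3, ?_⟩
  rw [show w - (w - t - s) - t = s by abel, hnorm, hfs, hgs]
  refine max_lt (lt_of_le_of_lt ?_ hwt) hwt
  rw [norm_smul]
  exact (mul_le_of_le_one_right (norm_nonneg _) (IsStarProjection.one P).norm_le_one').trans
    (NonUnitalStarAlgHom.norm_apply_le ψ _)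

end Products

/-! ### Ranks of products and the unital and nonunital cases -/

section Main

open scoped CStarAlgebra

/-- A C*-algebra with an identity is a unital C*-algebra. -/
theorem exists_cstarAlgebra_of_isUnital {A : Type*} (i : NonUnitalCStarAlgebra A)
    (h : IsUnital A) : ∃ j : CStarAlgebra A, j.toNonUnitalCStarAlgebra = i := by
  obtain ⟨e, he⟩ := h
  let r : Ring A := { i.toNonUnitalNormedRing.toNonUnitalRing with
    one := e
    one_mul := fun a => (he a).1
    mul_one := fun a => (he a).2 }
  let m : Module ℂ A := i.toNormedSpace.toModule
  let a : Algebra ℂ A := Algebra.ofModule (fun c x y => smul_mul_assoc c x y)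
    (fun c x y => mul_smul_comm c x y)
  let j : CStarAlgebra A :=
    { i, r with
      toAlgebra := a
      norm_smul_le := i.norm_smul_le }
  exact ⟨j, rfl⟩

section RankOfProduct

variable {E P Q : Type*} [CStarAlgebra E] [CStarAlgebra P] [CStarAlgebra Q]

/-- Elements of `ℕ∞` are determined by their finite upper bounds, and each such bound is a density
statement. One direction passes to quotients; the other is `h`. -/
theorem unitalGeneratorRank_eq_max {f : E →⋆ₐ[ℂ] P} {g : E →⋆ₐ[ℂ] Q}
    (hf : Function.Surjective f) (hg : Function.Surjective g)
    (h : ∀ k, Dense (GenSA P (k + 1)) → Dense (GenSA Q (k + 1)) → Dense (GenSA E (k + 1))) :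
    unitalGeneratorRank E = max (unitalGeneratorRank P) (unitalGeneratorRank Q) := by
  have key (n : ℕ) : unitalGeneratorRank E ≤ n ↔
      max (unitalGeneratorRank P) (unitalGeneratorRank Q) ≤ n := by
    rw [max_le_iff, unitalGeneratorRank_le_iff, unitalGeneratorRank_le_iff,
      unitalGeneratorRank_le_iff]
    exact ⟨fun hE => ⟨dense_genSA_of_surjective hf hE, dense_genSA_of_surjective hg hE⟩,
      fun hPQ => h n hPQ.1 hPQ.2⟩
  refine le_antisymm ?_ ?_
  · generalize hm : max (unitalGeneratorRank P) (unitalGeneratorRank Q) = m at key ⊢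
    induction m using ENat.recTopCoe with
    | top => exact le_top
    | coe m => exact (key m).2 le_rfl
  · generalize hm : unitalGeneratorRank E = m at key ⊢
    induction m using ENat.recTopCoe with
    | top => exact le_top
    | coe m => exact (key m).1 le_rfl

theorem unitalGeneratorRank_eq_max_of_prod (f : E →⋆ₐ[ℂ] P) (g : E →⋆ₐ[ℂ] Q)
    (hinj : ∀ z, f z = 0 → g z = 0 → z = 0) (hsurj : ∀ x y, ∃ z, f z = x ∧ g z = y)
    (hP : unitalRealRank P = 0) (hQ : unitalRealRank Q = 0) :
    unitalGeneratorRank E = max (unitalGeneratorRank P) (unitalGeneratorRank Q) :=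
  unitalGeneratorRank_eq_max (f := f) (g := g) (fun x => (hsurj x 0).imp fun _ h => h.1)
    (fun y => (hsurj 0 y).imp fun _ h => h.2) fun _ =>
      dense_genSA_of_prod f g hinj hsurj (dense_isUnit_of_unitalRealRank_eq_zero hP)
        (dense_isUnit_of_unitalRealRank_eq_zero hQ)

end RankOfProduct

/-- The scalar part, as a character of the unitization. -/
noncomputable def unitizationChar (A : Type*) [NonUnitalCStarAlgebra A] :
    Unitization ℂ A →⋆ₐ[ℂ] ℂ :=
  { Unitization.fstHom ℂ A with map_star' := fun _ => rfl }

section Cases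

theorem Unitization.fst_starMap {A B : Type*} [NonUnitalCStarAlgebra A] [NonUnitalCStarAlgebra B]
    (φ : A →⋆ₙₐ[ℂ] B) (z : Unitization ℂ A) : (Unitization.starMap φ z).fst = z.fst := by
  simp [Unitization.algebraMap_eq_inl]

theorem Unitization.snd_starMap {A B : Type*} [NonUnitalCStarAlgebra A] [NonUnitalCStarAlgebra B]
    (φ : A →⋆ₙₐ[ℂ] B) (z : Unitization ℂ A) : (Unitization.starMap φ z).snd = φ z.snd := by
  simp [Unitization.algebraMap_eq_inl]

theorem Unitization.starLift_eq {A C : Type*} [NonUnitalCStarAlgebra A] [CStarAlgebra C]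
    (φ : A →⋆ₙₐ[ℂ] C) (z : Unitization ℂ A) :
    Unitization.starLift φ z = algebraMap ℂ C z.fst + φ z.snd :=
  rfl

/-- When `A` is unital, the adjoined unit splits as the unit of `A` plus one adjoined to `B`, so the
unitization of `A × B` is the direct sum of `A` and the unitization of `B`. -/
theorem unitalGeneratorRank_unitization_prod_of_unital (A B : Type*) [CStarAlgebra A]
    [NonUnitalCStarAlgebra B] (hA : unitalRealRank A = 0)
    (hB : unitalRealRank (Unitization ℂ B) = 0) :
    unitalGeneratorRank (Unitization ℂ (A × B)) =
      max (unitalGeneratorRank A) (unitalGeneratorRank (Unitization ℂ B)) := by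
  refine unitalGeneratorRank_eq_max_of_prod
    (Unitization.starLift (NonUnitalStarAlgHom.fst ℂ A B))
    (Unitization.starMap (NonUnitalStarAlgHom.snd ℂ A B)) ?_ ?_ hA hB
  · intro z h1 h2
    have h3 : z.fst = 0 := by
      rw [← Unitization.fst_starMap (NonUnitalStarAlgHom.snd ℂ A B), h2, Unitization.fst_zero]
    rw [Unitization.starLift_eq, h3, map_zero, zero_add] at h1
    have h4 := Unitization.snd_starMap (NonUnitalStarAlgHom.snd ℂ A B) z
    rw [h2, Unitization.snd_zero] at h4
    exact Unitization.ext h3 (Prod.ext h1 h4.symm)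
  · intro x y
    refine ⟨⟨(y.fst, (x - algebraMap ℂ A y.fst, y.snd))⟩, ?_, ?_⟩
    · rw [Unitization.starLift_eq]
      exact add_sub_cancel _ _
    · exact Unitization.ext (Unitization.fst_starMap _ _) (Unitization.snd_starMap _ _)

theorem unitalGeneratorRank_unitization_prod_of_unital_right (A B : Type*)
    [NonUnitalCStarAlgebra A] [CStarAlgebra B] (hA : unitalRealRank (Unitization ℂ A) = 0)
    (hB : unitalRealRank B = 0) :
    unitalGeneratorRank (Unitization ℂ (A × B)) =
      max (unitalGeneratorRank (Unitization ℂ A)) (unitalGeneratorRank B) := by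
  refine unitalGeneratorRank_eq_max_of_prod
    (Unitization.starMap (NonUnitalStarAlgHom.fst ℂ A B))
    (Unitization.starLift (NonUnitalStarAlgHom.snd ℂ A B)) ?_ ?_ hA hB
  · intro z h2 h1
    have h3 : z.fst = 0 := by
      rw [← Unitization.fst_starMap (NonUnitalStarAlgHom.fst ℂ A B), h2, Unitization.fst_zero]
    rw [Unitization.starLift_eq, h3, map_zero, zero_add] at h1
    have h4 := Unitization.snd_starMap (NonUnitalStarAlgHom.fst ℂ A B) z
    rw [h2, Unitization.snd_zero] at h4
    exact Unitization.ext h3 (Prod.ext h4.symm h1)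
  · intro x y
    refine ⟨⟨(x.fst, (x.snd, y - algebraMap ℂ B x.fst))⟩, ?_, ?_⟩
    · exact Unitization.ext (Unitization.fst_starMap _ _) (Unitization.snd_starMap _ _)
    · rw [Unitization.starLift_eq]
      exact add_sub_cancel _ _

/-- The two unitizations share a single scalar part, so this is the pullback along the scalar
characters. -/
theorem unitalGeneratorRank_unitization_prod (A B : Type*)
    [NonUnitalCStarAlgebra A] [NonUnitalCStarAlgebra B]
    (hA : unitalRealRank (Unitization ℂ A) = 0) (hB : unitalRealRank (Unitization ℂ B) = 0) :
    unitalGeneratorRank (Unitization ℂ (A × B)) =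
      max (unitalGeneratorRank (Unitization ℂ A)) (unitalGeneratorRank (Unitization ℂ B)) := by
  refine unitalGeneratorRank_eq_max
    (f := Unitization.starMap (NonUnitalStarAlgHom.fst ℂ A B))
    (g := Unitization.starMap (NonUnitalStarAlgHom.snd ℂ A B))
    (Unitization.starMap_surjective Prod.fst_surjective)
    (Unitization.starMap_surjective Prod.snd_surjective) fun _ =>
    dense_genSA_of_pullback (Unitization.starMap (NonUnitalStarAlgHom.fst ℂ A B))
      (Unitization.starMap (NonUnitalStarAlgHom.snd ℂ A B)) (unitizationChar A) (unitizationChar B) ?_ ?_ ?_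
      (dense_isUnit_of_unitalRealRank_eq_zero hA) (dense_isUnit_of_unitalRealRank_eq_zero hB)
  · intro z h1 h2
    have h3 := Unitization.fst_starMap (NonUnitalStarAlgHom.fst ℂ A B) z
    have h4 := Unitization.snd_starMap (NonUnitalStarAlgHom.fst ℂ A B) z
    have h5 := Unitization.snd_starMap (NonUnitalStarAlgHom.snd ℂ A B) z
    rw [h1] at h3 h4
    rw [h2] at h5
    exact Unitization.ext h3.symm (Prod.ext h4.symm h5.symm)
  · intro z
    exact (Unitization.fst_starMap _ _).trans (Unitization.fst_starMap _ _).symm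
  · intro x y hxy
    refine ⟨⟨(x.fst, (x.snd, y.snd))⟩, ?_, ?_⟩
    · exact Unitization.ext (Unitization.fst_starMap _ _) (Unitization.snd_starMap _ _)
    · exact Unitization.ext ((Unitization.fst_starMap _ _).trans hxy) (Unitization.snd_starMap _ _)

end Cases

theorem isUnital_prod_iff {A B : Type*} [NonUnitalCStarAlgebra A] [NonUnitalCStarAlgebra B] :
    IsUnital (A × B) ↔ IsUnital A ∧ IsUnital B := by
  constructor
  · rintro ⟨e, he⟩
    exact ⟨⟨e.1, fun a => ⟨congrArg Prod.fst (he (a, 0)).1, congrArg Prod.fst (he (a, 0)).2⟩⟩,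
      ⟨e.2, fun b => ⟨congrArg Prod.snd (he (0, b)).1, congrArg Prod.snd (he (0, b)).2⟩⟩⟩
  · rintro ⟨⟨e, he⟩, ⟨e', he'⟩⟩
    exact ⟨(e, e'), fun x => ⟨Prod.ext (he x.1).1 (he' x.2).1, Prod.ext (he x.1).2 (he' x.2).2⟩⟩

end Main

theorem mainTheorem10 {A B : Type*} [NonUnitalCStarAlgebra A] [NonUnitalCStarAlgebra B]
    (hA : realRank A = 0) (hB : realRank B = 0) :
    generatorRank (A × B) = max (generatorRank A) (generatorRank B) := by
  rename_i i j
  unfold generatorRank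
  unfold realRank at hA hB
  by_cases uA : IsUnital A <;> by_cases uB : IsUnital B <;>
    simp only [uA, uB, isUnital_prod_iff, and_self, and_false, false_and, if_true, if_false]
      at hA hB ⊢
  -- Substituting the instance equality lets the unital results apply to the given structure itself,
  -- with no transport of ranks.
  · obtain ⟨i, rfl⟩ := exists_cstarAlgebra_of_isUnital i uA
    obtain ⟨j, rfl⟩ := exists_cstarAlgebra_of_isUnital j uB
    exact unitalGeneratorRank_eq_max_of_prod (StarAlgHom.fst ℂ A B) (StarAlgHom.snd ℂ A B)
      (fun z h1 h2 => Prod.ext h1 h2) (fun x y => ⟨(x, y), rfl, rfl⟩) hA hB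
  · obtain ⟨i, rfl⟩ := exists_cstarAlgebra_of_isUnital i uA
    exact unitalGeneratorRank_unitization_prod_of_unital A B hA hB
  · obtain ⟨j, rfl⟩ := exists_cstarAlgebra_of_isUnital j uB
    exact unitalGeneratorRank_unitization_prod_of_unital_right A B hA hB
  · exact unitalGeneratorRank_unitization_prod A B hA hB
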